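/- Let $\mathcal X\subset\mathbb C$ be a finite constellation whose symbols are used with probabilities $P_X(x)\ge 0$, $\sum_{x\in\mathcal X}P_X(x)=1$, and which has unit average energy, $\sum_{x\in\mathcal X}|x|^2P_X(x)=1$. For the channel $Y=H\sqrt{\mathrm{SNR}}\,X+Z$, with $X$, $H$, $Z$ independent, $Z$ circularly symmetric complex Gaussian of unit variance and the fading coefficient $H$ known at the receiver, let $$C_H(\mathrm{SNR})=-\mathbb E\Bigl[\log\sum_{x'\in\mathcal X}P_X(x')\,e^{-|H\sqrt{\mathrm{SNR}}(X-x')+Z|^2+|Z|^2}\Bigr]$$ be the constrained capacity, and write $C=C_1$ for its value in the absence of fading ($H\equiv 1$). Used with power $P$ and bandwidth $W$ in noise of spectral density $N_0$ (all positive), the system has $\mathrm{SNR}=P/(N_0W)$ and data rate $W\,C_H(\mathrm{SNR})$. The capacity in the absence of fading has an expansion $C(\mathrm{SNR})=c_1\mathrm{SNR}+c_2\mathrm{SNR}^2+o(\mathrm{SNR}^2)$ as $\mathrm{SNR}\downarrow 0$. Suppose that $c_1=1$. Let $\nu>0$ and let $H$ be Nakagami-$\nu$ fading, that is, $|H|^2$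 has the gamma distribution with shape $\nu$ and mean $1$. Compare the use of $\mathcal X$ in this fading channel with power $P_\nu>0$ and bandwidth $W_\nu>0$ with its use without fading, with power $P$, bandwidth $W$ and $\mathrm{SNR}=P/(N_0W)$. As $\mathrm{SNR}\downarrow0$ (uniformly over all $N_0,P,W>0$ with the given $\mathrm{SNR}$): 1. If $P_\nu=P$, then for all sufficiently small $\mathrm{SNR}$ there is a bandwidth $W_\nu$ for which the two data rates are equal, and every such $W_\nu$ satisfies $W_\nu=W\bigl(1+\tfrac1\nu+o(1)\bigr)$. 2. If $W_\nu=W$, then for all sufficiently small $\mathrm{SNR}$ there is a power $P_\nu$ for which the two data rates are equal, and every such $P_\nu$ satisfies $P_\nu=P\bigl(1-\tfrac{c_2}{\nu}\,\mathrm{SNR}+o(\mathrm{SNR})\bigr)$. -/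

import Mathlib

open MeasureTheory ProbabilityTheory Filter Topology Asymptotics

noncomputable section

/-- A finite modulation set in the complex plane, with the probabilities of its symbols. -/
structure Constellation where
  /-- the modulation symbols -/
  points : Finset ℂ
  /-- the probability with which each symbol is used -/
  prob : ℂ → ℝ
  prob_nonneg : ∀ x ∈ points, 0 ≤ prob x
  sum_prob : ∑ x ∈ points, prob x = 1

/-- The average energy `E[|X|²]` of a constellation. -/
def Constellation.energy (X : Constellation) : ℝ :=
  ∑ x ∈ X.points, ‖x‖ ^ 2 * X.prob x

/-- The law of circularly symmetric complex Gaussian noise of unit variance, with density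
`z ↦ exp (-|z|²) / π` with respect to Lebesgue measure on `ℂ`. -/
def complexNoise : Measure ℂ :=
  (volume : Measure ℂ).withDensity
    (fun z : ℂ => ENNReal.ofReal (1 / Real.pi * Real.exp (-‖z‖ ^ 2)))

/-- The constrained (coded modulation) capacity, in nats per channel use, of the channel
`Y = H √SNR X + Z`, where the fading coefficient `H` has law `fading` and is known at the receiver,
`Z` is Gaussian noise of unit variance, `X` is a random symbol of the constellation, and `X`, `H`,
`Z` are independent:
`-E[log (∑ x', P(x') exp (-|H √SNR (X - x') + Z|² + |Z|²))]`. -/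
def Constellation.capacity (X : Constellation) (fading : Measure ℂ) (snr : ℝ) : ℝ :=
  -∑ x ∈ X.points, X.prob x *
    ∫ w : ℂ × ℂ, Real.log (∑ x' ∈ X.points, X.prob x' *
      Real.exp (-‖w.1 * (Real.sqrt snr : ℂ) * (x - x') + w.2‖ ^ 2 + ‖w.2‖ ^ 2))
      ∂(fading.prod complexNoise)

/-- The law of the fading coefficient in the absence of fading: it is constantly `1`. -/
def noFading : Measure ℂ := Measure.dirac 1

/-- `fading` is the law of a Nakagami-`ν` fading coefficient `H`: the squared magnitude `|H|²` has
the gamma distribution of shape `ν` and rate `ν` (so of mean `1`). The law of the phase of `H` is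
arbitrary. -/
def IsNakagami (ν : ℝ) (fading : Measure ℂ) : Prop :=
  fading.map (fun h : ℂ => ‖h‖ ^ 2) = gammaMeasure ν ν

/-- `C(SNR) = c₁ SNR + c₂ SNR² + o(SNR²)` as `SNR` decreases to `0`. -/
def HasLowSNRExpansion (C : ℝ → ℝ) (c₁ c₂ : ℝ) : Prop :=
  (fun s : ℝ => C s - (c₁ * s + c₂ * s ^ 2)) =o[𝓝[>] 0] (fun s : ℝ => s ^ 2)

/-- The signal-to-noise ratio for noise spectral density `N₀`, power `P` and bandwidth `W`. -/
def signalToNoise (N₀ P W : ℝ) : ℝ := P / (N₀ * W)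

/-- The data rate (per unit time) of a system of capacity `C` per channel use, used with power `P`
and bandwidth `W` in noise of spectral density `N₀`. -/
def dataRate (C : ℝ → ℝ) (N₀ P W : ℝ) : ℝ := W * C (signalToNoise N₀ P W)

end

/-! Write `C` for the capacity without fading and `D` for the capacity with fading. Rotation
invariance of the noise makes the capacity at a fixed channel coefficient depend on its modulus
only, so `D s` is the average of `C (g * s)` over the gain `g = |H|²`. A gamma gain of mean `1` has
second moment `κ = 1 + 1/ν`. Averaging the expansion of `C` therefore gives `D s = s + c₂ κ s² +
o(s²)` (`HasLowSNRExpansion.average`).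

Let `s` and `t` be the signal-to-noise ratios without and with fading. With equal powers, equal
rates mean `D t / t = C s / s`, that is `1 + c₂ κ t ≈ 1 + c₂ s`, hence `Wν / W = s / t → κ`. With
equal bandwidths, they mean `D t = C s`, hence `t - s ≈ c₂ s² - c₂ κ s² = -(c₂/ν) s²`, where `t / s
= Pν / P`.

These computations presuppose that `t` is small and, for the bandwidth, that `c₂ ≠ 0`; a local
expansion gives neither. Two global facts do, both instances of Gibbs' inequality
(`sum_integral_log_nonpos`). The Gaussian bound `C s ≤ log (1 + s)` forces `c₂ < 0`, passes to `D`
by Jensen, and keeps `D t / t` below `1` away from `t = 0`. Monotonicity of `C`, by degrading the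
channel with extra noise, passes to `D` and excludes large solutions `t` of `D t = C s`. Solutions
exist by the intermediate value theorem.

That `C` has a second-order expansion at all comes from a fourth-order Taylor expansion in `u = √s`
with error `O(u⁵)`, in which symmetry under `u ↦ -u` removes the odd terms. -/

noncomputable section

/-! ### Circularly symmetric complex Gaussian noise -/

namespace complexNoise

lemma measurable_density :
    Measurable (fun z : ℂ => ENNReal.ofReal (1 / Real.pi * Real.exp (-‖z‖ ^ 2))) := by
  fun_prop

lemma integral_eq {E : Type*} [NormedAddCommGroup E] [NormedSpace ℝ E] (f : ℂ → E) :
    ∫ z, f z ∂complexNoise = ∫ z, (1 / Real.pi * Real.exp (-‖z‖ ^ 2)) • f z := by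
  rw [complexNoise, integral_withDensity_eq_integral_toReal_smul measurable_density (by simp)]
  congr 1 with z
  rw [ENNReal.toReal_ofReal (by positivity)]

lemma integrable_iff (f : ℂ → ℝ) :
    Integrable f complexNoise ↔
      Integrable (fun z => (1 / Real.pi * Real.exp (-‖z‖ ^ 2)) * f z) := by
  rw [complexNoise, integrable_withDensity_iff_integrable_smul' measurable_density (by simp)]
  refine integrable_congr (ae_of_all _ fun z => ?_)
  simp only [smul_eq_mul]
  rw [ENNReal.toReal_ofReal (by positivity)]

lemma integral_norm_pow_volume (n : ℕ) :
    ∫ z : ℂ, (1 / Real.pi * Real.exp (-‖z‖ ^ 2)) * ‖z‖ ^ n = Real.Gamma ((n + 2) / 2) := by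
  have h := Complex.integral_rpow_mul_exp_neg_rpow (p := 2) (q := n) (by norm_num)
    (by have := n.cast_nonneg (α := ℝ); linarith)
  simp only [Real.rpow_natCast, Real.rpow_ofNat] at h
  calc _ = ∫ z : ℂ, 1 / Real.pi * (‖z‖ ^ n * Real.exp (-‖z‖ ^ 2)) := by
        congr 1 with z; ring
    _ = _ := by
      rw [integral_const_mul, h]
      field_simp

lemma integrable_norm_pow (n : ℕ) : Integrable (fun z : ℂ => ‖z‖ ^ n) complexNoise := by
  rw [integrable_iff]
  -- The Bochner integral of a nonintegrable function is `0`, so a nonzero value proves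
  -- integrability.
  apply Integrable.of_integral_ne_zero
  rw [integral_norm_pow_volume]
  exact (Real.Gamma_pos_of_pos (by positivity)).ne'

lemma integral_norm_pow (n : ℕ) :
    ∫ z, ‖z‖ ^ n ∂complexNoise = Real.Gamma ((n + 2) / 2) := by
  rw [integral_eq]
  exact integral_norm_pow_volume n

lemma integral_norm_sq : ∫ z, ‖z‖ ^ 2 ∂complexNoise = 1 := by
  rw [integral_norm_pow]
  norm_num

instance : IsProbabilityMeasure complexNoise where
  measure_univ := by
    have h := integral_norm_pow_volume 0
    have hi := (integrable_iff _).1 (integrable_norm_pow 0)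
    rw [complexNoise, withDensity_apply _ MeasurableSet.univ, Measure.restrict_univ,
      ← ofReal_integral_eq_lintegral_ofReal]
    · simp only [pow_zero, mul_one] at h
      rw [h]
      norm_num
    · simpa using hi
    · exact ae_of_all _ fun z => by positivity

-- Laws are determined by their characteristic functions, so rotation invariance and stability under
-- normalized sums both reduce to this formula.
open RealInnerProductSpace in
lemma charFun_eq (t : ℂ) : charFun complexNoise t = Complex.exp (-‖t‖ ^ 2 / 4) := by
  have h := GaussianFourier.integral_cexp_neg_mul_sq_norm_add (V := ℂ) (b := 1) (by simp)
    Complex.I t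
  rw [charFun_apply, integral_eq]
  calc _ = ∫ z : ℂ, (1 / Real.pi : ℂ) * Complex.exp (-1 * ‖z‖ ^ 2 + Complex.I * (inner ℝ t z : ℝ)) := by
        congr 1 with z
        rw [Complex.exp_add, Complex.real_smul, real_inner_comm]
        push_cast
        rw [mul_comm Complex.I]
        ring_nf
    _ = _ := by
      rw [integral_const_mul, h]
      have : (Real.pi : ℂ) ≠ 0 := by exact_mod_cast Real.pi_ne_zero
      simp [Complex.finrank_real_complex, this, neg_div]

/-- The noise is circularly symmetric. -/
lemma map_const_mul {c : ℂ} (hc : ‖c‖ = 1) : complexNoise.map (c * ·) = complexNoise := by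
  have : IsProbabilityMeasure (complexNoise.map (c * ·)) :=
    Measure.isProbabilityMeasure_map (by fun_prop)
  apply Measure.ext_of_charFun
  ext t
  have : charFun (complexNoise.map (c * ·)) t = charFun complexNoise (starRingEnd ℂ c * t) := by
    rw [charFun_apply, charFun_apply, integral_map (by fun_prop) (by fun_prop)]
    congr 1 with z
    simp only [Complex.inner, _root_.map_mul]
    ring_nf
  rw [this, charFun_eq, charFun_eq]
  simp [hc]

lemma integral_comp_mul {c : ℂ} (hc : ‖c‖ = 1) (f : ℂ → ℝ)
    (hf : AEStronglyMeasurable f complexNoise) :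
    ∫ z, f (c * z) ∂complexNoise = ∫ z, f z ∂complexNoise := by
  conv_rhs => rw [← map_const_mul hc]
  rw [integral_map (by fun_prop)]
  rwa [map_const_mul hc]

/-- A normalized combination of two independent noises has the law of the noise. -/
lemma map_add_prod {ρ σ : ℝ} (h : ρ ^ 2 + σ ^ 2 = 1) :
    (complexNoise.prod complexNoise).map (fun z : ℂ × ℂ => ρ • z.1 + σ • z.2) = complexNoise := by
  have e : (complexNoise.prod complexNoise).map (fun z : ℂ × ℂ => ρ • z.1 + σ • z.2) =
      (complexNoise.map (ρ • ·)) ∗ (complexNoise.map (σ • ·)) := by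
    rw [Measure.conv, Measure.map_prod_map _ _ (by fun_prop) (by fun_prop),
      Measure.map_map (by fun_prop) (by fun_prop)]
    rfl
  have := Measure.isProbabilityMeasure_map (μ := complexNoise) (f := (ρ • ·)) (by fun_prop)
  have := Measure.isProbabilityMeasure_map (μ := complexNoise) (f := (σ • ·)) (by fun_prop)
  rw [e]
  apply Measure.ext_of_charFun
  ext t
  rw [charFun_conv, charFun_map_smul, charFun_map_smul, charFun_eq, charFun_eq, charFun_eq,
    ← Complex.exp_add]
  congr 1
  have : (ρ : ℂ) ^ 2 + σ ^ 2 = 1 := by exact_mod_cast h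
  simp only [norm_smul, Complex.ofReal_mul, mul_pow, Real.norm_eq_abs, ← Complex.ofReal_pow, sq_abs]
  push_cast
  linear_combination (-(‖t‖ : ℂ) ^ 2 / 4) * this

lemma integral_comp_add_left (a : ℂ) (f : ℂ → ℝ) :
    ∫ z, f (a + z) ∂complexNoise =
      ∫ y, (1 / Real.pi * Real.exp (-‖y - a‖ ^ 2)) * f y := by
  conv_rhs => rw [← integral_add_left_eq_self _ a]
  rw [integral_eq]
  simp

lemma integrable_comp_add_left_iff (a : ℂ) (f : ℂ → ℝ) :
    Integrable (fun z => f (a + z)) complexNoise ↔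
      Integrable (fun y => (1 / Real.pi * Real.exp (-‖y - a‖ ^ 2)) * f y) := by
  rw [integrable_iff]
  have := (measurePreserving_add_left (volume : Measure ℂ) a).integrable_comp_emb
    (MeasurableEquiv.addLeft a).measurableEmbedding
    (g := fun y => (1 / Real.pi * Real.exp (-‖y - a‖ ^ 2)) * f y)
  rw [← this]
  simp [Function.comp_def]

end complexNoise

/-! ### The logarithm of a mixture of exponentials -/

lemma sum_mul_exp_pos {ι : Type*} {s : Finset ι} {p : ι → ℝ} (hp : ∀ i ∈ s, 0 ≤ p i)
    (h1 : ∑ i ∈ s, p i = 1) (y : ι → ℝ) : 0 < ∑ i ∈ s, p i * Real.exp (y i) := by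
  apply Finset.sum_pos'
  · exact fun i hi => mul_nonneg (hp i hi) (Real.exp_pos _).le
  · by_contra! h
    have : ∑ i ∈ s, p i ≤ 0 := by
      apply Finset.sum_nonpos
      intro i hi
      by_contra! hpi
      have := h i hi
      have := mul_pos hpi (Real.exp_pos (y i))
      linarith
    linarith

/-- A convex combination of numbers in `[exp (-m), exp m]` stays in that interval. -/
lemma abs_log_sum_mul_exp_le {ι : Type*} {s : Finset ι} {p : ι → ℝ} (hp : ∀ i ∈ s, 0 ≤ p i)
    (h1 : ∑ i ∈ s, p i = 1) {y : ι → ℝ} {m : ℝ} (hy : ∀ i ∈ s, |y i| ≤ m) :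
    |Real.log (∑ i ∈ s, p i * Real.exp (y i))| ≤ m := by
  have hpos := sum_mul_exp_pos hp h1 y
  rw [abs_le]
  constructor
  · rw [Real.le_log_iff_exp_le hpos]
    calc Real.exp (-m) = ∑ i ∈ s, p i * Real.exp (-m) := by rw [← Finset.sum_mul, h1, one_mul]
      _ ≤ _ := Finset.sum_le_sum fun i hi =>
        mul_le_mul_of_nonneg_left (Real.exp_le_exp.2 (abs_le.1 (hy i hi)).1) (hp i hi)
  · rw [Real.log_le_iff_le_exp hpos]
    calc _ ≤ ∑ i ∈ s, p i * Real.exp m := Finset.sum_le_sum fun i hi =>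
        mul_le_mul_of_nonneg_left (Real.exp_le_exp.2 (abs_le.1 (hy i hi)).2) (hp i hi)
      _ = _ := by rw [← Finset.sum_mul, h1, one_mul]

lemma neg_norm_add_sq_add_norm_sq (v z : ℂ) :
    -‖v + z‖ ^ 2 + ‖z‖ ^ 2 = -‖v‖ ^ 2 - 2 * (v * starRingEnd ℂ z).re := by
  rw [← Complex.normSq_eq_norm_sq, ← Complex.normSq_eq_norm_sq, ← Complex.normSq_eq_norm_sq,
    Complex.normSq_add]
  ring

lemma abs_neg_norm_add_sq_add_norm_sq_le (v z : ℂ) :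
    |-‖v + z‖ ^ 2 + ‖z‖ ^ 2| ≤ ‖v‖ ^ 2 + 2 * ‖v‖ * ‖z‖ := by
  have h := Complex.abs_re_le_norm (v * starRingEnd ℂ z)
  rw [norm_mul, RCLike.norm_conj, abs_le] at h
  rw [neg_norm_add_sq_add_norm_sq, abs_le]
  constructor <;> nlinarith [sq_nonneg ‖v‖]

/-! ### Capacity at a fixed channel coefficient, and its average over the fading. -/

namespace Constellation

variable (X : Constellation)

/-- The mixture `∑ x', P(x') exp (-|w (x - x') + z|² + |z|²)`. -/
def mixture (x w z : ℂ) : ℝ :=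
  ∑ x' ∈ X.points, X.prob x' * Real.exp (-‖w * (x - x') + z‖ ^ 2 + ‖z‖ ^ 2)

/-- The capacity for a fixed effective channel coefficient `w = h √SNR`. -/
def coeffCapacity (w : ℂ) : ℝ :=
  -∑ x ∈ X.points, X.prob x * ∫ z, Real.log (X.mixture x w z) ∂complexNoise

lemma mixture_pos (x w z : ℂ) : 0 < X.mixture x w z :=
  sum_mul_exp_pos X.prob_nonneg X.sum_prob _

lemma continuous_log_mixture (x : ℂ) :
    Continuous (fun q : ℂ × ℂ => Real.log (X.mixture x q.1 q.2)) := by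
  apply Continuous.log
  · unfold mixture
    fun_prop
  · exact fun q => (X.mixture_pos x q.1 q.2).ne'

lemma exists_norm_sub_le : ∃ R : ℝ, 0 ≤ R ∧ ∀ x ∈ X.points, ∀ x' ∈ X.points, ‖x - x'‖ ≤ R := by
  refine ⟨2 * ∑ x ∈ X.points, ‖x‖, by positivity, fun x hx x' hx' => ?_⟩
  have h := fun y (hy : y ∈ X.points) =>
    Finset.single_le_sum (f := fun x : ℂ => ‖x‖) (fun i _ => norm_nonneg i) hy
  have := norm_sub_le x x'
  have := h x hx
  have := h x' hx'
  linarith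

/-- Each exponent is at most `(‖w‖R)² + 2‖w‖R‖z‖`, with `R` bounding the distances between symbols.
This is the dominating function for integrability and continuity, and it vanishes at `w = 0`. -/
lemma exists_abs_log_mixture_le : ∃ K : ℝ, 0 ≤ K ∧ ∀ x ∈ X.points, ∀ w z : ℂ,
    |Real.log (X.mixture x w z)| ≤ K * (‖w‖ ^ 2 + ‖w‖ * ‖z‖) := by
  obtain ⟨R, hR, h⟩ := X.exists_norm_sub_le
  refine ⟨R ^ 2 + 2 * R, by positivity, fun x hx w z => ?_⟩
  apply abs_log_sum_mul_exp_le X.prob_nonneg X.sum_prob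
  intro x' hx'
  refine (abs_neg_norm_add_sq_add_norm_sq_le _ _).trans ?_
  rw [norm_mul]
  have h1 : ‖w‖ * ‖x - x'‖ ≤ ‖w‖ * R := mul_le_mul_of_nonneg_left (h x hx x' hx') (norm_nonneg _)
  have h2 : (‖w‖ * ‖x - x'‖) ^ 2 ≤ (‖w‖ * R) ^ 2 := by gcongr
  have h3 : ‖w‖ * ‖x - x'‖ * ‖z‖ ≤ ‖w‖ * R * ‖z‖ := mul_le_mul_of_nonneg_right h1 (norm_nonneg _)
  have : 0 ≤ R * ‖w‖ ^ 2 := by positivity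
  have : 0 ≤ R ^ 2 * (‖w‖ * ‖z‖) := by positivity
  nlinarith

lemma integrable_log_mixture {x : ℂ} (hx : x ∈ X.points) (w : ℂ) :
    Integrable (fun z => Real.log (X.mixture x w z)) complexNoise := by
  obtain ⟨K, -, h⟩ := X.exists_abs_log_mixture_le
  have hi := complexNoise.integrable_norm_pow 1
  simp only [pow_one] at hi
  refine (((integrable_const (‖w‖ ^ 2)).add (hi.const_mul ‖w‖)).const_mul K).mono'
    ?_ (ae_of_all _ fun z => h x hx w z)
  exact ((X.continuous_log_mixture x).comp (Continuous.prodMk_right w)).aestronglyMeasurable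

lemma continuous_coeffCapacity : Continuous X.coeffCapacity := by
  obtain ⟨K, hK, h⟩ := X.exists_abs_log_mixture_le
  have hi := complexNoise.integrable_norm_pow 1
  simp only [pow_one] at hi
  refine (continuous_finsetSum _ fun x hx => continuous_const.mul ?_).neg
  rw [continuous_iff_continuousAt]
  intro w₀
  have hev : ∀ᶠ w in 𝓝 w₀, ‖w‖ ≤ ‖w₀‖ + 1 :=
    (continuous_norm.tendsto w₀).eventually_le_const (by linarith)
  apply continuousAt_of_dominated
    (bound := fun z => K * ((‖w₀‖ + 1) ^ 2 + (‖w₀‖ + 1) * ‖z‖))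
  · exact Eventually.of_forall fun w => (X.integrable_log_mixture hx w).aestronglyMeasurable
  · filter_upwards [hev] with w hw
    refine ae_of_all _ fun z => (h x hx w z).trans ?_
    gcongr
  · exact ((integrable_const _).add (hi.const_mul _)).const_mul K
  · exact ae_of_all _ fun z =>
      ((X.continuous_log_mixture x).comp (Continuous.prodMk_left z)).continuousAt

lemma exists_abs_coeffCapacity_le : ∃ K : ℝ, 0 ≤ K ∧ ∀ w : ℂ,
    |X.coeffCapacity w| ≤ K * (‖w‖ ^ 2 + ‖w‖) := by
  obtain ⟨K, hK, h⟩ := X.exists_abs_log_mixture_le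
  have hi := complexNoise.integrable_norm_pow 1
  simp only [pow_one] at hi
  set m := ∫ z, ‖z‖ ∂complexNoise with hm
  have hm0 : 0 ≤ m := integral_nonneg fun z => norm_nonneg z
  have hint : ∀ w : ℂ, Integrable (fun z : ℂ => ‖w‖ ^ 2 + ‖w‖ * ‖z‖) complexNoise := fun w =>
    (integrable_const _).add (hi.const_mul _)
  have hb : ∀ x ∈ X.points, ∀ w : ℂ,
      |∫ z, Real.log (X.mixture x w z) ∂complexNoise| ≤ K * (‖w‖ ^ 2 + ‖w‖ * m) := by
    intro x hx w
    rw [← Real.norm_eq_abs]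
    refine (norm_integral_le_of_norm_le ((hint w).const_mul K)
      (ae_of_all _ fun z => h x hx w z)).trans_eq ?_
    rw [integral_const_mul, integral_add (integrable_const _) (hi.const_mul _),
      integral_const_mul, ← hm]
    simp
  refine ⟨K * (1 + m), by positivity, fun w => ?_⟩
  rw [coeffCapacity, abs_neg]
  calc _ ≤ ∑ x ∈ X.points, X.prob x * (K * (‖w‖ ^ 2 + ‖w‖ * m)) := by
        refine (Finset.abs_sum_le_sum_abs _ _).trans (Finset.sum_le_sum fun x hx => ?_)
        rw [abs_mul, abs_of_nonneg (X.prob_nonneg x hx)]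
        exact mul_le_mul_of_nonneg_left (hb x hx w) (X.prob_nonneg x hx)
    _ = K * (‖w‖ ^ 2 + ‖w‖ * m) := by rw [← Finset.sum_mul, X.sum_prob, one_mul]
    _ ≤ _ := by
      have : 0 ≤ K * (‖w‖ + m * ‖w‖ ^ 2) := by positivity
      nlinarith

lemma coeffCapacity_zero : X.coeffCapacity 0 = 0 := by
  obtain ⟨K, -, h⟩ := X.exists_abs_coeffCapacity_le
  simpa using h 0

/-- The capacity for a fixed coefficient depends on its magnitude only. -/
lemma coeffCapacity_mul {c : ℂ} (hc : ‖c‖ = 1) (w : ℂ) :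
    X.coeffCapacity (c * w) = X.coeffCapacity w := by
  unfold coeffCapacity
  congr 1
  refine Finset.sum_congr rfl fun x hx => ?_
  -- Rotating the noise by the same `c` as the coefficient leaves every norm in the mixture
  -- unchanged.
  rw [← complexNoise.integral_comp_mul hc _
    (X.integrable_log_mixture hx (c * w)).aestronglyMeasurable]
  congr 2 with z
  unfold mixture
  have h1 : ∀ x', ‖c * w * (x - x') + c * z‖ = ‖w * (x - x') + z‖ := fun x' => by
    rw [mul_assoc, ← mul_add, norm_mul, hc, one_mul]
  simp only [h1, norm_mul, hc, one_mul]

lemma coeffCapacity_norm (w : ℂ) : X.coeffCapacity ‖w‖ = X.coeffCapacity w := by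
  rcases eq_or_ne w 0 with rfl | hw
  · simp
  have hn : (‖w‖ : ℂ) ≠ 0 := by simpa using hw
  conv_rhs => rw [← div_mul_cancel₀ w hn]
  rw [coeffCapacity_mul]
  simp [hw]

lemma integrable_log_mixture_prod {fading : Measure ℂ} [IsProbabilityMeasure fading]
    (hf : Integrable (fun h : ℂ => ‖h‖ ^ 2) fading) {x : ℂ} (hx : x ∈ X.points) (u : ℝ) :
    Integrable (fun q : ℂ × ℂ => Real.log (X.mixture x (q.1 * u) q.2))
      (fading.prod complexNoise) := by
  obtain ⟨K, hK, h⟩ := X.exists_abs_log_mixture_le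
  have hi := complexNoise.integrable_norm_pow 1
  simp only [pow_one] at hi
  have hf1 : Integrable (fun h : ℂ => ‖h‖) fading := by
    refine (hf.add (integrable_const 1)).mono' (by fun_prop) (ae_of_all _ fun z => ?_)
    simp only [norm_norm, Pi.add_apply]
    nlinarith [sq_nonneg (‖z‖ - 1 / 2)]
  have hg : Integrable (fun q : ℂ × ℂ =>
      K * (u ^ 2 * ‖q.1‖ ^ 2 + |u| * (‖q.1‖ * ‖q.2‖))) (fading.prod complexNoise) :=
    (((hf.comp_fst complexNoise).const_mul _).add ((hf1.mul_prod hi).const_mul _)).const_mul K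
  refine hg.mono' ?_ (ae_of_all _ fun q => (h x hx _ _).trans_eq ?_)
  · exact ((X.continuous_log_mixture x).comp (by fun_prop :
      Continuous fun q : ℂ × ℂ => (q.1 * (u : ℂ), q.2))).aestronglyMeasurable
  · rw [norm_mul, Complex.norm_real, Real.norm_eq_abs, mul_pow, sq_abs]
    ring

lemma capacity_eq_integral {fading : Measure ℂ} [IsProbabilityMeasure fading]
    (hf : Integrable (fun h : ℂ => ‖h‖ ^ 2) fading) (s : ℝ) :
    X.capacity fading s = ∫ h : ℂ, X.coeffCapacity (h * Real.sqrt s) ∂fading := by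
  unfold coeffCapacity
  rw [integral_neg, integral_finsetSum]
  · unfold capacity
    congr 1
    refine Finset.sum_congr rfl fun x hx => ?_
    rw [integral_const_mul]
    congr 1
    exact integral_prod _ (X.integrable_log_mixture_prod hf hx (Real.sqrt s))
  · exact fun x hx =>
      ((X.integrable_log_mixture_prod hf hx (Real.sqrt s)).integral_prod_left).const_mul _

lemma capacity_noFading (s : ℝ) :
    X.capacity noFading s = X.coeffCapacity (Real.sqrt s) := by
  unfold noFading
  rw [X.capacity_eq_integral (integrable_dirac (by simp))]
  simp

lemma continuous_capacity_noFading : Continuous (X.capacity noFading) := by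
  rw [funext X.capacity_noFading]
  exact X.continuous_coeffCapacity.comp (by fun_prop)

lemma exists_abs_capacity_noFading_le : ∃ K : ℝ, 0 ≤ K ∧ ∀ s : ℝ, 0 ≤ s →
    |X.capacity noFading s| ≤ K * (1 + s) := by
  obtain ⟨K, hK, h⟩ := X.exists_abs_coeffCapacity_le
  refine ⟨2 * K, by positivity, fun s hs => ?_⟩
  rw [capacity_noFading]
  refine (h _).trans ?_
  rw [Complex.norm_real, Real.norm_eq_abs, sq_abs, Real.sq_sqrt hs, abs_of_nonneg (by positivity)]
  have : Real.sqrt s ≤ 1 + s := by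
    nlinarith [Real.sq_sqrt hs, sq_nonneg (Real.sqrt s - 1)]
  have := mul_le_mul_of_nonneg_left this hK
  nlinarith

lemma capacity_noFading_zero : X.capacity noFading 0 = 0 := by
  simp [capacity_noFading, coeffCapacity_zero]

/-- The fading capacity averages the capacity without fading over the channel gain. -/
lemma capacity_eq_integral_gain {fading : Measure ℂ} [IsProbabilityMeasure fading]
    (hf : Integrable (fun h : ℂ => ‖h‖ ^ 2) fading) (s : ℝ) :
    X.capacity fading s =
      ∫ g : ℝ, X.capacity noFading (g * s) ∂(fading.map fun h : ℂ => ‖h‖ ^ 2) := by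
  have hc : Continuous fun g : ℝ => X.capacity noFading (g * s) :=
    X.continuous_capacity_noFading.comp (by fun_prop)
  rw [X.capacity_eq_integral hf, integral_map (by fun_prop) hc.aestronglyMeasurable]
  congr 1 with h
  rw [capacity_noFading, ← X.coeffCapacity_norm, norm_mul, Complex.norm_real, Real.norm_eq_abs,
    abs_of_nonneg (Real.sqrt_nonneg s), Real.sqrt_mul (by positivity),
    Real.sqrt_sq (norm_nonneg h)]

end Constellation

/-! ### Variational bounds on the capacity -/

lemma complexNoise.integrable_re_mul_conj (v : ℂ) :
    Integrable (fun z => (v * starRingEnd ℂ z).re) complexNoise := by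
  have hi := complexNoise.integrable_norm_pow 1
  refine (hi.const_mul ‖v‖).mono' (by fun_prop) (ae_of_all _ fun z => ?_)
  refine (Complex.abs_re_le_norm _).trans_eq ?_
  rw [norm_mul, RCLike.norm_conj, pow_one]

lemma complexNoise.integral_re_mul_conj (v : ℂ) :
    ∫ z, (v * starRingEnd ℂ z).re ∂complexNoise = 0 := by
  have h := complexNoise.integral_comp_mul (c := -1) (by simp) _
    (complexNoise.integrable_re_mul_conj v).aestronglyMeasurable
  simp only [neg_mul, one_mul, map_neg, mul_neg, Complex.neg_re, integral_neg] at h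
  linarith

lemma norm_add_sq_eq (v z : ℂ) :
    ‖v + z‖ ^ 2 = ‖v‖ ^ 2 + 2 * (v * starRingEnd ℂ z).re + ‖z‖ ^ 2 := by
  linarith [neg_norm_add_sq_add_norm_sq v z]

lemma complexNoise.integrable_norm_add_sq (v : ℂ) :
    Integrable (fun z => ‖v + z‖ ^ 2) complexNoise := by
  simp only [norm_add_sq_eq]
  exact ((integrable_const _).add ((complexNoise.integrable_re_mul_conj v).const_mul 2)).add
    (complexNoise.integrable_norm_pow 2)

lemma complexNoise.integral_norm_add_sq (v : ℂ) :
    ∫ z, ‖v + z‖ ^ 2 ∂complexNoise = ‖v‖ ^ 2 + 1 := by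
  simp only [norm_add_sq_eq]
  have hre := (complexNoise.integrable_re_mul_conj v).const_mul 2
  have h1 := integral_add ((integrable_const (‖v‖ ^ 2)).add hre) (complexNoise.integrable_norm_pow 2)
  simp only [Pi.add_apply] at h1
  rw [h1, integral_add (integrable_const _) hre, integral_const_mul, complexNoise.integral_re_mul_conj, complexNoise.integral_norm_sq]
  simp

namespace Constellation

variable (X : Constellation)

/-- The density of the channel output, up to the factor `π`, when the channel coefficient is `w`. -/
def outputMass (w y : ℂ) : ℝ :=
  ∑ x ∈ X.points, X.prob x * Real.exp (-‖y - w * x‖ ^ 2)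

lemma outputMass_pos (w y : ℂ) : 0 < X.outputMass w y :=
  sum_mul_exp_pos X.prob_nonneg X.sum_prob _

lemma continuous_outputMass (w : ℂ) : Continuous (X.outputMass w) := by
  unfold outputMass
  fun_prop

lemma mixture_eq_outputMass (x w z : ℂ) :
    X.mixture x w z = X.outputMass w (w * x + z) * Real.exp (‖z‖ ^ 2) := by
  unfold mixture outputMass
  rw [Finset.sum_mul]
  refine Finset.sum_congr rfl fun x' _ => ?_
  rw [mul_assoc, ← Real.exp_add]
  congr 5
  ring_nf

lemma log_outputMass (x w z : ℂ) :
    Real.log (X.outputMass w (w * x + z)) = Real.log (X.mixture x w z) - ‖z‖ ^ 2 := by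
  rw [mixture_eq_outputMass, Real.log_mul (X.outputMass_pos _ _).ne' (Real.exp_pos _).ne',
    Real.log_exp]
  ring

lemma integrable_gaussian_sub (a : ℂ) :
    Integrable (fun y : ℂ => 1 / Real.pi * Real.exp (-‖y - a‖ ^ 2)) := by
  have := (complexNoise.integrable_comp_add_left_iff a fun _ => 1).1 (integrable_const 1)
  simpa using this

lemma integral_gaussian_sub (a : ℂ) :
    ∫ y : ℂ, 1 / Real.pi * Real.exp (-‖y - a‖ ^ 2) = 1 := by
  have := complexNoise.integral_comp_add_left a fun _ => 1
  simpa using this.symm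

lemma integrable_outputMass (w : ℂ) :
    Integrable (fun y => 1 / Real.pi * X.outputMass w y) := by
  simp only [outputMass, Finset.mul_sum, mul_left_comm (1 / Real.pi)]
  exact integrable_finsetSum _ fun x _ => (integrable_gaussian_sub _).const_mul _

lemma integral_outputMass (w : ℂ) : ∫ y, 1 / Real.pi * X.outputMass w y = 1 := by
  simp only [outputMass, Finset.mul_sum, mul_left_comm (1 / Real.pi)]
  rw [integral_finsetSum _ fun x _ => (integrable_gaussian_sub _).const_mul _]
  refine (Finset.sum_congr rfl fun x _ => ?_).trans X.sum_prob
  rw [integral_const_mul (X.prob x), integral_gaussian_sub, mul_one]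

/-- Gibbs' inequality for the joint law of the channel input and output, with respect to the
density ratio `t`. -/
lemma sum_integral_log_nonpos (w : ℂ) {t : ℂ → ℂ → ℝ} {h : ℂ → ℝ}
    (hpos : ∀ x y, 0 < t x y) (hcont : ∀ x, Continuous (t x))
    (hlog : ∀ x ∈ X.points, Integrable (fun z => Real.log (t x (w * x + z))) complexNoise)
    (hint : Integrable h) (hone : ∫ y, h y = 1)
    (hsum : ∀ y, ∑ x ∈ X.points, X.prob x * (1 / Real.pi * Real.exp (-‖y - w * x‖ ^ 2) * t x y)
      = h y) :
    ∑ x ∈ X.points, X.prob x * ∫ z, Real.log (t x (w * x + z)) ∂complexNoise ≤ 0 := by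
  have hnn : ∀ x ∈ X.points, ∀ y,
      0 ≤ X.prob x * (1 / Real.pi * Real.exp (-‖y - w * x‖ ^ 2) * t x y) := fun x hx y =>
    mul_nonneg (X.prob_nonneg x hx) (mul_nonneg (by positivity) (hpos x y).le)
  -- Integrability of `t` is not assumed: the summands are nonnegative, so each is dominated by
  -- their sum `h`.
  have hvol : ∀ x ∈ X.points, Integrable
      (fun y => X.prob x * (1 / Real.pi * Real.exp (-‖y - w * x‖ ^ 2) * t x y)) := by
    intro x hx
    refine hint.mono' ?_ (ae_of_all _ fun y => ?_)
    · have := hcont x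
      exact Continuous.aestronglyMeasurable (by fun_prop)
    · rw [Real.norm_eq_abs, abs_of_nonneg (hnn x hx y), ← hsum y]
      exact Finset.single_le_sum (fun x hx => hnn x hx y) hx
  have hti : ∀ x ∈ X.points, Integrable (fun z => X.prob x * t x (w * x + z)) complexNoise := by
    intro x hx
    rw [complexNoise.integrable_comp_add_left_iff (w * x) (fun y => X.prob x * t x y)]
    refine (hvol x hx).congr (ae_of_all _ fun y => ?_)
    simp only
    ring
  have htot : ∑ x ∈ X.points, ∫ z, X.prob x * t x (w * x + z) ∂complexNoise = 1 := by
    rw [← hone, ← funext hsum, integral_finsetSum _ hvol]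
    refine Finset.sum_congr rfl fun x _ => ?_
    rw [complexNoise.integral_comp_add_left (w * x) (fun y => X.prob x * t x y)]
    congr 1 with y
    ring
  -- Integrate `log t ≤ t - 1`; by `htot`, `t` has expectation `1` under the joint law.
  calc _ ≤ ∑ x ∈ X.points, (∫ z, X.prob x * t x (w * x + z) ∂complexNoise - X.prob x) := by
        refine Finset.sum_le_sum fun x hx => ?_
        have hc : X.prob x = ∫ _, X.prob x ∂complexNoise := by simp
        conv_rhs => rw [hc]
        rw [← integral_const_mul, ← integral_sub]
        · refine integral_mono ((hlog x hx).const_mul _) ?_ fun z => ?_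
          · simp only [integral_const, probReal_univ, one_smul]
            exact (hti x hx).sub (integrable_const (X.prob x))
          · have := mul_le_mul_of_nonneg_left
              (Real.log_le_sub_one_of_pos (hpos x (w * x + z))) (X.prob_nonneg x hx)
            simp only [integral_const, probReal_univ, one_smul]
            linarith
        · simpa using hti x hx
        · exact integrable_const _
    _ = 0 := by rw [Finset.sum_sub_distrib, htot, X.sum_prob, sub_self]

/-- The constrained capacity is at most the capacity of the Gaussian channel. -/
theorem capacity_noFading_le_log (hX : X.energy = 1) {s : ℝ} (hs : 0 ≤ s) :
    X.capacity noFading s ≤ Real.log (1 + s) := by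
  have hs1 : 0 < 1 + s := by linarith
  set w : ℂ := (Real.sqrt s : ℂ) with hw
  have hw2 : ‖w‖ ^ 2 = s := by
    rw [hw, Complex.norm_real, Real.norm_eq_abs, sq_abs, Real.sq_sqrt hs]
  -- The Gaussian density of variance `1 + s`, the energy of the output, divided by the true output
  -- density; the factors `1/π` cancel.
  set t : ℂ → ℂ → ℝ := fun _ y =>
    Real.exp (-(1 / (1 + s)) * ‖y‖ ^ 2) / (1 + s) / X.outputMass w y with ht
  have hlogt : ∀ x z, Real.log (t x (w * x + z)) =
      -(1 / (1 + s)) * ‖w * x + z‖ ^ 2 - Real.log (1 + s) - Real.log (X.mixture x w z)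
        + ‖z‖ ^ 2 := by
    intro x z
    rw [ht]
    simp only
    rw [Real.log_div (by positivity) (X.outputMass_pos _ _).ne',
      Real.log_div (Real.exp_pos _).ne' hs1.ne', Real.log_exp, X.log_outputMass]
    ring
  have hi1 := fun v => (complexNoise.integrable_norm_add_sq v).const_mul (-(1 / (1 + s)))
  have hi2 := fun v => (hi1 v).sub (integrable_const (Real.log (1 + s)))
  have hi3 := fun x hx v => (hi2 v).sub (X.integrable_log_mixture (x := x) hx w)
  have hpi := Real.pi_pos
  have hg := X.sum_integral_log_nonpos w (t := t)
    (h := fun y => 1 / Real.pi / (1 + s) * Real.exp (-(1 / (1 + s)) * ‖y‖ ^ 2))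
    (fun x y => div_pos (by positivity) (X.outputMass_pos w y))
    (fun x => Continuous.div (by fun_prop) (X.continuous_outputMass w)
      fun y => (X.outputMass_pos w y).ne')
    (fun x hx => by
      simp only [hlogt]
      exact (hi3 x hx _).add (complexNoise.integrable_norm_pow 2))
    ?_ ?_ ?_
  · have hval : ∀ x ∈ X.points, ∫ z, Real.log (t x (w * x + z)) ∂complexNoise =
        -(1 / (1 + s)) * (s * ‖x‖ ^ 2 + 1) - Real.log (1 + s) + 1
          - ∫ z, Real.log (X.mixture x w z) ∂complexNoise := by
      intro x hx
      simp only [hlogt]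
      have a1 := integral_add (hi3 x hx (w * x)) (complexNoise.integrable_norm_pow 2)
      have a2 := integral_sub (hi2 (w * x)) (X.integrable_log_mixture hx w)
      have a3 := integral_sub (hi1 (w * x)) (integrable_const (Real.log (1 + s)))
      simp only [Pi.sub_apply] at a1 a2 a3
      rw [a1, a2, a3, integral_const_mul, complexNoise.integral_norm_add_sq,
        complexNoise.integral_norm_sq, norm_mul, mul_pow, hw2]
      simp
      ring
    have hE : ∑ x ∈ X.points, ‖x‖ ^ 2 * X.prob x = 1 := hX
    rw [Finset.sum_congr rfl fun x hx => by rw [hval x hx]] at hg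
    rw [capacity_noFading, ← hw, coeffCapacity]
    have key : ∑ x ∈ X.points, X.prob x * (-(1 / (1 + s)) * (s * ‖x‖ ^ 2 + 1) - Real.log (1 + s) + 1
        - ∫ z, Real.log (X.mixture x w z) ∂complexNoise) =
        -(s / (1 + s)) * (∑ x ∈ X.points, ‖x‖ ^ 2 * X.prob x) +
        (-(1 / (1 + s)) - Real.log (1 + s) + 1) * (∑ x ∈ X.points, X.prob x) -
        ∑ x ∈ X.points, X.prob x * ∫ z, Real.log (X.mixture x w z) ∂complexNoise := by
      rw [Finset.mul_sum, Finset.mul_sum, ← Finset.sum_add_distrib, ← Finset.sum_sub_distrib]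
      refine Finset.sum_congr rfl fun x _ => ?_
      ring
    rw [key, hE, X.sum_prob] at hg
    have : -(s / (1 + s)) * 1 + (-(1 / (1 + s)) - Real.log (1 + s) + 1) * 1 = -Real.log (1 + s) := by
      field_simp
      ring
    linarith
  · apply Integrable.const_mul
    apply Integrable.of_integral_ne_zero
    rw [GaussianFourier.integral_rexp_neg_mul_sq_norm (by positivity)]
    positivity
  · rw [integral_const_mul, GaussianFourier.integral_rexp_neg_mul_sq_norm (by positivity)]
    simp
    field_simp
  · intro y
    have h0 := (X.outputMass_pos w y).ne'
    calc _ = (1 / Real.pi * t 0 y) * X.outputMass w y := by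
          conv_rhs => rw [outputMass, Finset.mul_sum]
          refine Finset.sum_congr rfl fun x _ => ?_
          simp only [ht]
          ring
      _ = _ := by
          simp only [ht]
          field_simp

/-- Degrading the channel by additional noise does not increase the capacity. -/
lemma coeffCapacity_smul_le (w : ℂ) {ρ σ : ℝ} (h : ρ ^ 2 + σ ^ 2 = 1) :
    X.coeffCapacity (ρ * w) ≤ X.coeffCapacity w := by
  have hy : ∀ x z ζ : ℂ, ρ • (w * x + z) + σ • ζ = ρ * w * x + (ρ • z + σ • ζ) := fun x z ζ => by
    simp only [Complex.real_smul]
    ring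
  have hprod : ∀ x ∈ X.points, Integrable (fun q : ℂ × ℂ =>
      Real.log (X.mixture x (ρ * w) (ρ • q.1 + σ • q.2))) (complexNoise.prod complexNoise) := by
    intro x hx
    have hi := X.integrable_log_mixture hx (ρ * w)
    rw [← complexNoise.map_add_prod h] at hi
    exact hi.comp_measurable (by fun_prop)
  have hval : ∀ x ∈ X.points,
      ∫ ζ, ∫ z, Real.log (X.mixture x (ρ * w) (ρ • z + σ • ζ)) ∂complexNoise ∂complexNoise =
      ∫ z, Real.log (X.mixture x (ρ * w) z) ∂complexNoise := by
    intro x hx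
    have hi := X.integrable_log_mixture hx (ρ * w)
    have e := integral_prod_symm _ (hprod x hx)
    rw [← e]
    conv_rhs => rw [← complexNoise.map_add_prod h]
    rw [integral_map (by fun_prop)]
    rw [complexNoise.map_add_prod h]
    exact hi.aestronglyMeasurable
  have hpt : ∀ᵐ ζ ∂complexNoise, 0 ≤ X.coeffCapacity w +
      ∑ x ∈ X.points, X.prob x *
        ∫ z, Real.log (X.mixture x (ρ * w) (ρ • z + σ • ζ)) ∂complexNoise := by
    -- Gibbs' inequality is applied for each fixed `ζ`; Fubini provides the integrability only for
    -- almost every `ζ`.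
    have hae : ∀ᵐ ζ ∂complexNoise, ∀ x ∈ X.points, Integrable (fun z =>
        Real.log (X.mixture x (ρ * w) (ρ • z + σ • ζ))) complexNoise := by
      rw [eventually_all_finset]
      exact fun x hx => (hprod x hx).prod_left_ae
    filter_upwards [hae] with ζ hζ
    -- With `y' = ρ y + σ ζ`, this is `p(y) p(y'|x) / (p(y|x) p(y'))`, whose logarithm is the
    -- information density of the degraded channel minus that of the original one.
    set t : ℂ → ℂ → ℝ := fun x y => X.outputMass w y * Real.exp (‖y - w * x‖ ^ 2) *
      Real.exp (-‖(ρ • y + σ • ζ) - ρ * w * x‖ ^ 2) /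
        X.outputMass (ρ * w) (ρ • y + σ • ζ) with ht
    have htpos : ∀ x y, 0 < t x y := fun x y => div_pos (mul_pos (mul_pos
      (X.outputMass_pos _ _) (Real.exp_pos _)) (Real.exp_pos _)) (X.outputMass_pos _ _)
    have hlogt : ∀ x z, Real.log (t x (w * x + z)) = Real.log (X.mixture x w z) -
        Real.log (X.mixture x (ρ * w) (ρ • z + σ • ζ)) := by
      intro x z
      simp only [ht, hy]
      rw [Real.log_div (mul_pos (mul_pos (X.outputMass_pos _ _) (Real.exp_pos _))
          (Real.exp_pos _)).ne' (X.outputMass_pos _ _).ne',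
        Real.log_mul (mul_pos (X.outputMass_pos _ _) (Real.exp_pos _)).ne' (Real.exp_pos _).ne',
        Real.log_mul (X.outputMass_pos _ _).ne' (Real.exp_pos _).ne', Real.log_exp, Real.log_exp,
        X.log_outputMass, X.log_outputMass, add_sub_cancel_left, add_sub_cancel_left]
      ring
    have hg := X.sum_integral_log_nonpos w (t := t)
      (h := fun y => 1 / Real.pi * X.outputMass w y) htpos
      (fun x => Continuous.div (by
          have := X.continuous_outputMass w
          fun_prop)
        ((X.continuous_outputMass _).comp (by fun_prop)) fun y => (X.outputMass_pos _ _).ne')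
      (fun x hx => by
        simp only [hlogt]
        exact (X.integrable_log_mixture hx w).sub (hζ x hx))
      (X.integrable_outputMass w) (X.integral_outputMass w) ?_
    · rw [Finset.sum_congr rfl fun x hx => by
        simp only [hlogt]
        rw [integral_sub (X.integrable_log_mixture hx w) (hζ x hx), mul_sub],
        Finset.sum_sub_distrib] at hg
      rw [coeffCapacity]
      linarith
    · intro y
      have h0 := (X.outputMass_pos (ρ * w) (ρ • y + σ • ζ)).ne'
      calc _ = (1 / Real.pi * X.outputMass w y / X.outputMass (ρ * w) (ρ • y + σ • ζ)) *
            X.outputMass (ρ * w) (ρ • y + σ • ζ) := by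
            have hA : ∀ A : ℝ, A * X.outputMass (ρ * w) (ρ • y + σ • ζ) = ∑ x ∈ X.points,
                A * (X.prob x * Real.exp (-‖(ρ • y + σ • ζ) - ρ * w * x‖ ^ 2)) :=
              fun A => Finset.mul_sum _ _ _
            rw [hA]
            refine Finset.sum_congr rfl fun x _ => ?_
            simp only [ht]
            have : Real.exp (-‖y - w * x‖ ^ 2) * Real.exp (‖y - w * x‖ ^ 2) = 1 := by
              rw [← Real.exp_add]; simp
            linear_combination (exp := 1) (X.prob x * (1 / Real.pi) * X.outputMass w y *
              Real.exp (-‖(ρ • y + σ • ζ) - ρ * w * x‖ ^ 2) /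
                X.outputMass (ρ * w) (ρ • y + σ • ζ)) * this
        _ = _ := by field_simp
  have hin : ∀ x ∈ X.points, Integrable (fun ζ => X.prob x *
      ∫ z, Real.log (X.mixture x (ρ * w) (ρ • z + σ • ζ)) ∂complexNoise) complexNoise :=
    fun x hx => ((hprod x hx).integral_prod_right).const_mul _
  have hfin := integral_nonneg_of_ae hpt
  rw [integral_add (integrable_const _) (integrable_finsetSum _ hin), integral_finsetSum _ hin] at hfin
  rw [Finset.sum_congr rfl fun x hx => by rw [integral_const_mul, hval x hx]] at hfin
  simp only [integral_const, probReal_univ, one_smul] at hfin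
  conv_lhs => rw [coeffCapacity]
  linarith

/-- The capacity is a nondecreasing function of the signal-to-noise ratio. -/
theorem capacity_noFading_mono {s s' : ℝ} (hs : 0 ≤ s) (h : s ≤ s') :
    X.capacity noFading s ≤ X.capacity noFading s' := by
  -- The case `s = 0` is separate because `s'` may then vanish too; it uses pure noise, `ρ = 0`.
  -- Otherwise `ρ² = s / s'`.
  rcases hs.eq_or_lt with rfl | hs0
  · have := X.coeffCapacity_smul_le (Real.sqrt s') (ρ := 0) (σ := 1) (by norm_num)
    simpa [capacity_noFading] using this
  have hs' : 0 < s' := hs0.trans_le h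
  have hq : s / s' ≤ 1 := (div_le_one hs').2 h
  have := X.coeffCapacity_smul_le (Real.sqrt s') (ρ := Real.sqrt (s / s'))
    (σ := Real.sqrt (1 - s / s')) (by
      rw [Real.sq_sqrt (by positivity), Real.sq_sqrt (by linarith)]; ring)
  rw [← Complex.ofReal_mul, ← Real.sqrt_mul (by positivity), div_mul_cancel₀ _ hs'.ne'] at this
  simpa only [capacity_noFading] using this

end Constellation

/-! ### Low-SNR expansion of the capacity -/

/-- Fourth-order Taylor polynomial of `exp y - 1`. -/
def expTaylor {R : Type*} [Ring R] [Algebra ℝ R] (y : R) : R :=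
  y + (1 / 2 : ℝ) • y ^ 2 + (1 / 6 : ℝ) • y ^ 3 + (1 / 24 : ℝ) • y ^ 4

/-- Fourth-order Taylor polynomial of `log (1 + y)`. -/
def logTaylor {R : Type*} [Ring R] [Algebra ℝ R] (y : R) : R :=
  y - (1 / 2 : ℝ) • y ^ 2 + (1 / 3 : ℝ) • y ^ 3 - (1 / 4 : ℝ) • y ^ 4

lemma abs_exp_sub_one_sub_expTaylor_le {y : ℝ} (hy : |y| ≤ 1) :
    |Real.exp y - 1 - expTaylor y| ≤ |y| ^ 5 := by
  have h := Real.exp_bound hy (n := 5) (by norm_num)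
  have e : Real.exp y - 1 - expTaylor y =
      Real.exp y - ∑ m ∈ Finset.range 5, y ^ m / m.factorial := by
    simp [Finset.sum_range_succ, expTaylor, Nat.factorial]
    ring
  rw [e]
  refine h.trans (mul_le_of_le_one_right (by positivity) ?_)
  norm_num [Nat.factorial]

lemma abs_log_one_add_sub_logTaylor_le {y : ℝ} (hy : |y| ≤ 1 / 2) :
    |Real.log (1 + y) - logTaylor y| ≤ 2 * |y| ^ 5 := by
  have h := Real.abs_log_sub_add_sum_range_le (x := -y) (by rw [abs_neg]; linarith) 4
  rw [abs_neg, sub_neg_eq_add] at h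
  have e : Real.log (1 + y) - logTaylor y =
      ∑ i ∈ Finset.range 4, (-y) ^ (i + 1) / (i + 1) + Real.log (1 + y) := by
    simp [Finset.sum_range_succ, logTaylor]
    ring
  rw [e]
  refine h.trans ?_
  rw [div_le_iff₀ (by linarith)]
  norm_num
  have : 0 ≤ |y| ^ 5 := by positivity
  nlinarith

/-- The difference quotient is a polynomial whose terms of degrees `0` to `3` each contribute at
most `1` on `[-1, 1]`. -/
lemma abs_logTaylor_sub_le {a b : ℝ} (ha : |a| ≤ 1) (hb : |b| ≤ 1) :
    |logTaylor a - logTaylor b| ≤ 4 * |a - b| := by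
  have e : logTaylor a - logTaylor b = (1 - (a + b) / 2 + (a ^ 2 + a * b + b ^ 2) / 3 -
      (a ^ 3 + a ^ 2 * b + a * b ^ 2 + b ^ 3) / 4) * (a - b) := by
    simp only [logTaylor, smul_eq_mul]
    ring
  rw [e, abs_mul]
  refine mul_le_mul_of_nonneg_right ?_ (abs_nonneg _)
  have hm : ∀ i j : ℕ, |a ^ i * b ^ j| ≤ 1 := fun i j => by
    rw [abs_mul, abs_pow, abs_pow]
    exact mul_le_one₀ (pow_le_one₀ (abs_nonneg _) ha) (by positivity)
      (pow_le_one₀ (abs_nonneg _) hb)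
  have h10 := abs_le.1 (hm 1 0)
  have h01 := abs_le.1 (hm 0 1)
  have h20 := abs_le.1 (hm 2 0)
  have h11 := abs_le.1 (hm 1 1)
  have h02 := abs_le.1 (hm 0 2)
  have h30 := abs_le.1 (hm 3 0)
  have h21 := abs_le.1 (hm 2 1)
  have h12 := abs_le.1 (hm 1 2)
  have h03 := abs_le.1 (hm 0 3)
  simp only [pow_zero, pow_one, mul_one, one_mul] at *
  rw [abs_le]
  constructor <;> linarith

lemma abs_logTaylor_le {q B : ℝ} (hB : 1 ≤ B) (hq : |q| ≤ B) : |logTaylor q| ≤ 4 * B ^ 4 := by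
  have h : ∀ n ≤ 4, |q ^ n| ≤ B ^ 4 := fun n hn => by
    rw [abs_pow]
    exact (pow_le_pow_left₀ (abs_nonneg _) hq n).trans (pow_le_pow_right₀ hB hn)
  have h1 := abs_le.1 (h 1 (by norm_num))
  have h2 := abs_le.1 (h 2 (by norm_num))
  have h3 := abs_le.1 (h 3 (by norm_num))
  have h4 := abs_le.1 (h 4 (by norm_num))
  simp only [logTaylor, smul_eq_mul, pow_one] at *
  rw [abs_le]
  constructor <;> linarith

lemma abs_expTaylor_le {y m : ℝ} (hy : |y| ≤ m) : |expTaylor y| ≤ (1 + m) ^ 4 := by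
  have hm : 0 ≤ m := (abs_nonneg _).trans hy
  have h : ∀ n, |y ^ n| ≤ m ^ n := fun n => by
    rw [abs_pow]
    exact pow_le_pow_left₀ (abs_nonneg _) hy n
  have h1 := abs_le.1 (h 1)
  have h2 := abs_le.1 (h 2)
  have h3 := abs_le.1 (h 3)
  have h4 := abs_le.1 (h 4)
  have : (1 + m) ^ 4 = 1 + 4 * m + 6 * m ^ 2 + 4 * m ^ 3 + m ^ 4 := by ring
  have : 0 ≤ m ^ 2 := by positivity
  have : 0 ≤ m ^ 3 := by positivity
  have : 0 ≤ m ^ 4 := by positivity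
  simp only [expTaylor, smul_eq_mul, pow_one] at *
  rw [abs_le]
  constructor <;> linarith

section Mixture

variable {ι : Type*} {s : Finset ι} {p : ι → ℝ}

lemma abs_sum_mul_le (hp : ∀ i ∈ s, 0 ≤ p i) (h1 : ∑ i ∈ s, p i = 1) {f : ι → ℝ} {B : ℝ}
    (hf : ∀ i ∈ s, |f i| ≤ B) : |∑ i ∈ s, p i * f i| ≤ B :=
  calc _ ≤ ∑ i ∈ s, p i * B := by
        refine (Finset.abs_sum_le_sum_abs _ _).trans (Finset.sum_le_sum fun i hi => ?_)
        rw [abs_mul, abs_of_nonneg (hp i hi)]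
        exact mul_le_mul_of_nonneg_left (hf i hi) (hp i hi)
    _ = B := by rw [← Finset.sum_mul, h1, one_mul]

/-- Fourth-order expansion of a cumulant generating function, with a global error bound. -/
lemma abs_log_sum_mul_exp_sub_le (hp : ∀ i ∈ s, 0 ≤ p i) (h1 : ∑ i ∈ s, p i = 1)
    {y : ι → ℝ} {m : ℝ} (hm : 0 ≤ m) (hy : ∀ i ∈ s, |y i| ≤ m) :
    |Real.log (∑ i ∈ s, p i * Real.exp (y i)) - logTaylor (∑ i ∈ s, p i * expTaylor (y i))|
      ≤ 6000 * (m ^ 5 * (1 + m) ^ 16) := by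
  have hone : (1 : ℝ) ≤ (1 + m) ^ 16 := one_le_pow₀ (by linarith)
  -- For small `m` the Taylor remainders give `64 m⁵ + 4 m⁵`. For `m ≥ 1/4` no cancellation is
  -- needed: both terms are bounded separately.
  rcases le_total m (1 / 4) with hm4 | hm4
  · set S := ∑ i ∈ s, p i * (Real.exp (y i) - 1) with hS
    set Q := ∑ i ∈ s, p i * expTaylor (y i) with hQ
    have e : ∑ i ∈ s, p i * Real.exp (y i) = 1 + S := by
      rw [hS]
      simp only [mul_sub, Finset.sum_sub_distrib, mul_one, h1]
      ring
    have hS2 : |S| ≤ 2 * m := abs_sum_mul_le hp h1 fun i hi =>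
      (Real.abs_exp_sub_one_le (by linarith [hy i hi])).trans (by linarith [hy i hi])
    have hSQ : |S - Q| ≤ m ^ 5 := by
      rw [hS, hQ, ← Finset.sum_sub_distrib]
      simp only [← mul_sub]
      exact abs_sum_mul_le hp h1 fun i hi =>
        (abs_exp_sub_one_sub_expTaylor_le (by linarith [hy i hi])).trans
          (pow_le_pow_left₀ (abs_nonneg _) (hy i hi) 5)
    have hm5 : m ^ 5 ≤ m := pow_le_of_le_one hm (by linarith) (by norm_num)
    have hQ1 : |Q| ≤ 1 := by
      have := abs_sub_abs_le_abs_sub Q S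
      rw [abs_sub_comm] at this
      linarith
    have hA := abs_log_one_add_sub_logTaylor_le (y := S) (by linarith)
    have hB := abs_logTaylor_sub_le (a := S) (b := Q) (by linarith) hQ1
    have hC : |S| ^ 5 ≤ 32 * m ^ 5 := by
      calc _ ≤ (2 * m) ^ 5 := pow_le_pow_left₀ (abs_nonneg _) hS2 5
        _ = _ := by ring
    rw [e]
    have := abs_sub_le (Real.log (1 + S)) (logTaylor S) (logTaylor Q)
    have : 0 ≤ m ^ 5 := by positivity
    nlinarith
  -- The total is at most `m + 4 (1 + m)¹⁶ ≤ 5 (1 + m)¹⁶`, and `1 ≤ 4⁵ m⁵`; `5 · 4⁵ = 5120` is below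
  -- `6000`.
  · have hA := abs_log_sum_mul_exp_le hp h1 hy
    have hB := abs_logTaylor_le (one_le_pow₀ (by linarith))
      (abs_sum_mul_le hp h1 fun i hi => abs_expTaylor_le (hy i hi))
    rw [← pow_mul] at hB
    norm_num at hB
    have h5 : (1 / 4 : ℝ) ^ 5 ≤ m ^ 5 := pow_le_pow_left₀ (by norm_num) hm4 5
    have hm1 : m ≤ (1 + m) ^ 16 :=
      (by linarith : m ≤ 1 + m).trans (le_self_pow₀ (by linarith) (by norm_num))
    have := abs_sub (Real.log (∑ i ∈ s, p i * Real.exp (y i)))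
      (logTaylor (∑ i ∈ s, p i * expTaylor (y i)))
    have : (1 / 4 : ℝ) ^ 5 * (1 + m) ^ 16 ≤ m ^ 5 * (1 + m) ^ 16 := by gcongr
    norm_num at this
    linarith

end Mixture

/-- Continuous functions of polynomial growth on the complex plane. -/
def polyGrowth : Subalgebra ℝ (ℂ → ℝ) where
  carrier := {f | Continuous f ∧ ∃ (K : ℝ) (n : ℕ), 0 ≤ K ∧ ∀ z, |f z| ≤ K * (1 + ‖z‖) ^ n}
  mul_mem' := by
    rintro f g ⟨hf, K, n, hK, h⟩ ⟨hg, K', n', hK', h'⟩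
    refine ⟨hf.mul hg, K * K', n + n', by positivity, fun z => ?_⟩
    rw [Pi.mul_apply, abs_mul]
    calc _ ≤ (K * (1 + ‖z‖) ^ n) * (K' * (1 + ‖z‖) ^ n') :=
          mul_le_mul (h z) (h' z) (abs_nonneg _) (by positivity)
      _ = _ := by ring
  add_mem' := by
    rintro f g ⟨hf, K, n, hK, h⟩ ⟨hg, K', n', hK', h'⟩
    refine ⟨hf.add hg, K + K', max n n', by positivity, fun z => ?_⟩
    have h1 : 1 ≤ 1 + ‖z‖ := by linarith [norm_nonneg z]
    have := mul_le_mul_of_nonneg_left (pow_le_pow_right₀ h1 (le_max_left n n')) hK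
    have := mul_le_mul_of_nonneg_left (pow_le_pow_right₀ h1 (le_max_right n n')) hK'
    rw [Pi.add_apply]
    refine (abs_add_le _ _).trans ?_
    linarith [h z, h' z]
  algebraMap_mem' := fun r =>
    ⟨continuous_const, |r|, 0, abs_nonneg r, fun z => by simp⟩

/-- Evaluation at a point, as a homomorphism. -/
def polyGrowth.evalAt (z : ℂ) : polyGrowth →ₐ[ℝ] ℝ :=
  (Pi.evalAlgHom ℝ (fun _ : ℂ => ℝ) z).comp polyGrowth.val

lemma complexNoise.integrable_one_add_norm_pow (n : ℕ) :
    Integrable (fun z : ℂ => (1 + ‖z‖) ^ n) complexNoise := by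
  refine (((integrable_const 1).add (complexNoise.integrable_norm_pow n)).const_mul
    (2 ^ (n - 1))).mono' (by fun_prop) (ae_of_all _ fun z => ?_)
  rw [Real.norm_eq_abs, abs_of_nonneg (by positivity)]
  simpa using add_pow_le (zero_le_one (α := ℝ)) (norm_nonneg z) n

lemma polyGrowth.integrable (f : polyGrowth) :
    Integrable (fun z => polyGrowth.evalAt z f) complexNoise := by
  obtain ⟨f, hf, K, n, hK, h⟩ := f
  exact ((complexNoise.integrable_one_add_norm_pow n).const_mul K).mono'
    hf.aestronglyMeasurable (ae_of_all _ h)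

open Polynomial in
/-- Integrating a polynomial with coefficients of polynomial growth yields a polynomial. -/
lemma polyGrowth.exists_integral_eval_eq (p : polyGrowth[X]) : ∃ q : ℝ[X], ∀ u : ℝ,
    ∫ z, polyGrowth.evalAt z (p.eval (algebraMap ℝ polyGrowth u)) ∂complexNoise = q.eval u := by
  refine ⟨∑ i ∈ Finset.range (p.natDegree + 1),
    C (∫ z, polyGrowth.evalAt z (p.coeff i) ∂complexNoise) * X ^ i, fun u => ?_⟩
  have e : ∀ z, polyGrowth.evalAt z (p.eval (algebraMap ℝ polyGrowth u)) =
      ∑ i ∈ Finset.range (p.natDegree + 1), polyGrowth.evalAt z (p.coeff i) * u ^ i := by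
    intro z
    rw [eval_eq_sum_range, map_sum]
    simp
  simp only [e, eval_finsetSum, eval_mul, eval_C, eval_pow, eval_X]
  rw [integral_finsetSum _ fun i _ => (polyGrowth.integrable (p.coeff i)).mul_const _]
  simp only [integral_mul_const]

/-! ### Taylor approximation of the capacity in `u = √s`. -/

namespace Constellation

variable (X : Constellation)

/-- The Taylor approximation of `log (mixture x u z)` as a function of real `u`. -/
def mixtureTaylor (x : ℂ) (u : ℝ) (z : ℂ) : ℝ :=
  logTaylor (∑ x' ∈ X.points, X.prob x' * expTaylor (-‖(u : ℂ) * (x - x') + z‖ ^ 2 + ‖z‖ ^ 2))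

/-- The function `z ↦ Re (d z̄)` as an element of `polyGrowth`. -/
def reMulConj (d : ℂ) : polyGrowth :=
  ⟨fun z => (d * starRingEnd ℂ z).re, by fun_prop, ‖d‖, 1, norm_nonneg d, fun z => by
    refine (Complex.abs_re_le_norm _).trans ?_
    rw [norm_mul, RCLike.norm_conj, pow_one]
    exact mul_le_mul_of_nonneg_left (by linarith) (norm_nonneg d)⟩

open Polynomial in
/-- `mixtureTaylor` as a polynomial in `u`. -/
def mixtureTaylorPolynomial (x : ℂ) : polyGrowth[X] :=
  logTaylor (∑ x' ∈ X.points, X.prob x' •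
    expTaylor ((-‖x - x'‖ ^ 2) • (Polynomial.X : polyGrowth[X]) ^ 2 +
      (-2 : ℝ) • (C (reMulConj (x - x')) * Polynomial.X)))

/-- Substituting `u` and evaluating at `z` is an algebra homomorphism, so it commutes with
`expTaylor` and `logTaylor`, which use only algebra operations. -/
lemma eval_mixtureTaylorPolynomial (x : ℂ) (u : ℝ) (z : ℂ) :
    polyGrowth.evalAt z ((X.mixtureTaylorPolynomial x).eval (algebraMap ℝ polyGrowth u)) =
      X.mixtureTaylor x u z := by
  let ψ : Polynomial polyGrowth →ₐ[ℝ] polyGrowth :=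
    (Polynomial.aeval (algebraMap ℝ polyGrowth u)).restrictScalars ℝ
  have hφψ : polyGrowth.evalAt z
      ((X.mixtureTaylorPolynomial x).eval (algebraMap ℝ polyGrowth u)) =
      ((polyGrowth.evalAt z).comp ψ) (X.mixtureTaylorPolynomial x) := by
    simp [ψ]
  rw [hφψ, mixtureTaylorPolynomial, mixtureTaylor]
  have h1 : ((polyGrowth.evalAt z).comp ψ) Polynomial.X = u := by
    simp [ψ]
  have h2 : ∀ x', ((polyGrowth.evalAt z).comp ψ) (Polynomial.C (reMulConj (x - x'))) =
      ((x - x') * starRingEnd ℂ z).re := by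
    intro x'
    simp [ψ, polyGrowth.evalAt, reMulConj]
  have h3 : ∀ x', -‖(u : ℂ) * (x - x') + z‖ ^ 2 + ‖z‖ ^ 2 =
      -‖x - x'‖ ^ 2 * u ^ 2 + (-2) * (((x - x') * starRingEnd ℂ z).re * u) := by
    intro x'
    rw [neg_norm_add_sq_add_norm_sq, norm_mul, mul_pow, mul_assoc (u : ℂ), Complex.re_ofReal_mul,
      Complex.norm_real, Real.norm_eq_abs, sq_abs]
    ring
  simp only [h3]
  simp only [logTaylor, expTaylor, map_add, map_sub, map_smul, map_pow, map_sum, map_mul, h1, h2,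
    smul_eq_mul]

/-- All exponents are at most `|u| c (1 + ‖z‖)`, so the cumulant error bound factors as `|u|⁵` times
a power of `1 + ‖z‖`, of degree `21 = 5 + 16`, which the Gaussian integrates. -/
lemma exists_abs_log_mixture_sub_mixtureTaylor_le : ∃ M : ℂ → ℝ, Integrable M complexNoise ∧
    ∀ x ∈ X.points, ∀ u : ℝ, |u| ≤ 1 → ∀ z,
      |Real.log (X.mixture x u z) - X.mixtureTaylor x u z| ≤ |u| ^ 5 * M z := by
  obtain ⟨R, hR, hRx⟩ := X.exists_norm_sub_le
  obtain ⟨c, hc0, hc⟩ : ∃ c : ℝ, 0 ≤ c ∧ c = R ^ 2 + 2 * R := ⟨_, by positivity, rfl⟩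
  refine ⟨fun z => 6000 * (c ^ 5 * (1 + c) ^ 16) * (1 + ‖z‖) ^ 21,
    (complexNoise.integrable_one_add_norm_pow 21).const_mul _, fun x hx u hu z => ?_⟩
  have hz := norm_nonneg z
  have hy : ∀ x' ∈ X.points, |-‖(u : ℂ) * (x - x') + z‖ ^ 2 + ‖z‖ ^ 2| ≤
      |u| * (c * (1 + ‖z‖)) := by
    intro x' hx'
    refine (abs_neg_norm_add_sq_add_norm_sq_le _ _).trans ?_
    rw [norm_mul, Complex.norm_real, Real.norm_eq_abs]
    have h1 := hRx x hx x' hx'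
    calc (|u| * ‖x - x'‖) ^ 2 + 2 * (|u| * ‖x - x'‖) * ‖z‖
        ≤ (|u| * R) ^ 2 + 2 * (|u| * R) * ‖z‖ := by gcongr
      _ = |u| * (|u| * R ^ 2 + 2 * R * ‖z‖) := by ring
      _ ≤ |u| * (1 * R ^ 2 + 2 * R * ‖z‖) := by gcongr
      _ ≤ _ := by
        gcongr
        rw [hc]
        have : 0 ≤ R ^ 2 * ‖z‖ := by positivity
        linarith
  refine (abs_log_sum_mul_exp_sub_le X.prob_nonneg X.sum_prob (by positivity) hy).trans ?_
  have h2 : 1 + |u| * (c * (1 + ‖z‖)) ≤ (1 + c) * (1 + ‖z‖) := by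
    have : |u| * (c * (1 + ‖z‖)) ≤ 1 * (c * (1 + ‖z‖)) := by gcongr
    linarith
  calc 6000 * ((|u| * (c * (1 + ‖z‖))) ^ 5 * (1 + |u| * (c * (1 + ‖z‖))) ^ 16)
      ≤ 6000 * ((|u| * (c * (1 + ‖z‖))) ^ 5 * ((1 + c) * (1 + ‖z‖)) ^ 16) := by gcongr
    _ = |u| ^ 5 * (6000 * (c ^ 5 * (1 + c) ^ 16) * (1 + ‖z‖) ^ 21) := by
      rw [mul_pow, mul_pow, mul_pow, show 21 = 5 + 16 from rfl, pow_add (1 + ‖z‖)]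
      simp only [mul_assoc, mul_left_comm, mul_comm]

/-- Integrating the Taylor polynomial over the noise leaves a polynomial in `u`. Order five suffices
because `s² = u⁴`. -/
lemma exists_polynomial_coeffCapacity : ∃ (q : Polynomial ℝ) (K : ℝ), ∀ u : ℝ, |u| ≤ 1 →
    |X.coeffCapacity u - q.eval u| ≤ K * |u| ^ 5 := by
  obtain ⟨M, hMi, hpt⟩ := X.exists_abs_log_mixture_sub_mixtureTaylor_le
  have hev : ∀ x u, (fun z => X.mixtureTaylor x u z) =
      fun z => polyGrowth.evalAt z
        ((X.mixtureTaylorPolynomial x).eval (algebraMap ℝ polyGrowth u)) := fun x u =>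
    funext fun z => (X.eval_mixtureTaylorPolynomial x u z).symm
  choose q hq using fun x => polyGrowth.exists_integral_eval_eq (X.mixtureTaylorPolynomial x)
  refine ⟨-∑ x ∈ X.points, Polynomial.C (X.prob x) * q x, ∫ z, M z ∂complexNoise, fun u hu => ?_⟩
  have hx : ∀ x ∈ X.points, |∫ z, Real.log (X.mixture x u z) ∂complexNoise - (q x).eval u| ≤
      |u| ^ 5 * ∫ z, M z ∂complexNoise := by
    intro x hx
    have hi : Integrable (fun z => X.mixtureTaylor x u z) complexNoise := by
      rw [hev]
      exact polyGrowth.integrable _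
    rw [← hq x u, ← hev x u, ← integral_sub (X.integrable_log_mixture hx u) hi,
      ← integral_const_mul, ← Real.norm_eq_abs]
    exact norm_integral_le_of_norm_le (hMi.const_mul _) (ae_of_all _ fun z => hpt x hx u hu z)
  have e : X.coeffCapacity u - (-∑ x ∈ X.points, Polynomial.C (X.prob x) * q x).eval u =
      -∑ x ∈ X.points, X.prob x *
        (∫ z, Real.log (X.mixture x u z) ∂complexNoise - (q x).eval u) := by
    simp only [coeffCapacity, Polynomial.eval_neg, Polynomial.eval_finsetSum, Polynomial.eval_mul,
      Polynomial.eval_C, mul_sub, Finset.sum_sub_distrib]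
    ring
  rw [e, abs_neg, mul_comm]
  exact abs_sum_mul_le X.prob_nonneg X.sum_prob hx

theorem exists_hasLowSNRExpansion : ∃ c₁ c₂ : ℝ,
    HasLowSNRExpansion (X.capacity noFading) c₁ c₂ := by
  obtain ⟨q, K, hq⟩ := X.exists_polynomial_coeffCapacity
  obtain ⟨a, r, hr⟩ : ∃ (a : ℕ → ℝ) (r : Polynomial ℝ), ∀ u : ℝ, q.eval u =
      a 0 + a 1 * u + a 2 * u ^ 2 + a 3 * u ^ 3 + a 4 * u ^ 4 + u ^ 5 * r.eval u := by
    refine ⟨q.coeff, q.divX.divX.divX.divX.divX, fun u => ?_⟩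
    have h : ∀ p : Polynomial ℝ, p.eval u = p.divX.eval u * u + p.coeff 0 := fun p => by
      conv_lhs => rw [← Polynomial.divX_mul_X_add p]
      simp
    rw [h q, h q.divX, h q.divX.divX, h q.divX.divX.divX, h q.divX.divX.divX.divX]
    simp only [Polynomial.coeff_divX]
    ring
  obtain ⟨B, hB⟩ := (isCompact_Icc (a := (-1 : ℝ)) (b := 1)).exists_bound_of_continuousOn
    r.continuous.continuousOn
  have hB0 : 0 ≤ B := (norm_nonneg _).trans (hB 0 (by simp))
  have h0 : a 0 = 0 := by
    have := hq 0 (by simp)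
    rw [hr] at this
    simpa [X.coeffCapacity_zero] using this
  have hbound : ∀ s : ℝ, 0 ≤ s → s ≤ 1 →
      |X.capacity noFading s - (a 2 * s + a 4 * s ^ 2)| ≤ (K + B) * (s ^ 2 * Real.sqrt s) := by
    intro s hs hs1
    set u := Real.sqrt s with hu
    have hu0 : 0 ≤ u := Real.sqrt_nonneg s
    have hu1 : u ≤ 1 := Real.sqrt_le_one.2 hs1
    have hus : u ^ 2 = s := Real.sq_sqrt hs
    -- Averaging the estimates at `u` and `-u` cancels `a 1` and `a 3`, without showing that they
    -- vanish.
    have hneg : X.coeffCapacity ((-u : ℝ) : ℂ) = X.coeffCapacity u := by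
      rw [← X.coeffCapacity_mul (c := -1) (by simp) u]
      simp
    have h1 := hq u (by rwa [abs_of_nonneg hu0])
    have h2 := hq (-u) (by rwa [abs_neg, abs_of_nonneg hu0])
    rw [hneg, hr, abs_neg, abs_of_nonneg hu0, h0] at h2
    rw [hr, abs_of_nonneg hu0, h0] at h1
    have b1 := hB u ⟨by linarith, hu1⟩
    have b2 := hB (-u) ⟨by linarith, by linarith⟩
    rw [Real.norm_eq_abs, abs_le] at b1 b2
    have h5 : 0 ≤ u ^ 5 := by positivity
    have m1 := mul_le_mul_of_nonneg_left b1.1 h5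
    have m2 := mul_le_mul_of_nonneg_left b1.2 h5
    have m3 := mul_le_mul_of_nonneg_left b2.1 h5
    have m4 := mul_le_mul_of_nonneg_left b2.2 h5
    rw [capacity_noFading, ← hu, ← hus]
    rw [abs_le] at h1 h2 ⊢
    ring_nf at h1 h2 m1 m2 m3 m4 ⊢
    constructor <;> linarith
  refine ⟨a 2, a 4, ?_⟩
  have hO : (fun s : ℝ => X.capacity noFading s - (a 2 * s + a 4 * s ^ 2)) =O[𝓝[>] 0]
      (fun s : ℝ => s ^ 2 * Real.sqrt s) := by
    refine IsBigO.of_bound (K + B) ?_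
    filter_upwards [Ioc_mem_nhdsGT (zero_lt_one (α := ℝ))] with s hs
    rw [Real.norm_eq_abs, Real.norm_eq_abs,
      abs_of_nonneg (by positivity : 0 ≤ s ^ 2 * Real.sqrt s)]
    exact hbound s hs.1.le hs.2
  refine hO.trans_isLittleO ?_
  have hs : (fun s : ℝ => Real.sqrt s) =o[𝓝[>] 0] (fun _ => (1 : ℝ)) := by
    rw [isLittleO_one_iff]
    have := Real.continuous_sqrt.tendsto 0
    rw [Real.sqrt_zero] at this
    exact this.mono_left nhdsWithin_le_nhds
  simpa using (isBigO_refl (fun s : ℝ => s ^ 2) _).mul_isLittleO hs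

end Constellation

/-! ### Averaging over the channel gain -/

section GammaMoments

variable {ν : ℝ}

lemma integral_gammaPDFReal_mul_pow (hν : 0 < ν) (n : ℕ) :
    ∫ x, gammaPDFReal ν ν x * x ^ n = Real.Gamma (ν + n) / (Real.Gamma ν * ν ^ n) := by
  have hsupp : ∀ x : ℝ, x ∉ Set.Ici (0 : ℝ) → gammaPDFReal ν ν x * x ^ n = 0 := fun x hx => by
    rw [gammaPDFReal, if_neg (by simpa using hx), zero_mul]
  rw [← setIntegral_eq_integral_of_forall_compl_eq_zero hsupp, integral_Ici_eq_integral_Ioi]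
  have e : ∀ x ∈ Set.Ioi (0 : ℝ), gammaPDFReal ν ν x * x ^ n =
      ν ^ ν / Real.Gamma ν * (x ^ (ν + n - 1) * Real.exp (-(ν * x))) := by
    intro x hx
    have hx0 : 0 < x := hx
    rw [gammaPDFReal, if_pos hx0.le, show ν + n - 1 = (ν - 1) + n by ring, Real.rpow_add hx0,
      Real.rpow_natCast]
    ring
  rw [setIntegral_congr_fun measurableSet_Ioi e, integral_const_mul,
    Real.integral_rpow_mul_exp_neg_mul_Ioi (by positivity) hν, one_div, Real.inv_rpow hν.le,
    Real.rpow_add hν, Real.rpow_natCast]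
  have := (Real.rpow_pos_of_pos hν ν).ne'
  have := (Real.Gamma_pos_of_pos hν).ne'
  field_simp

lemma integrable_pow_gammaMeasure (hν : 0 < ν) (n : ℕ) :
    Integrable (fun x : ℝ => x ^ n) (gammaMeasure ν ν) := by
  rw [gammaMeasure, integrable_withDensity_iff_integrable_smul'
    (by unfold gammaPDF; fun_prop) (by simp [gammaPDF])]
  simp only [gammaPDF, ENNReal.toReal_ofReal (gammaPDFReal_nonneg hν hν _), smul_eq_mul]
  apply Integrable.of_integral_ne_zero
  rw [integral_gammaPDFReal_mul_pow hν]
  have := Real.Gamma_pos_of_pos hν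
  have := Real.Gamma_pos_of_pos (s := ν + n) (by positivity)
  positivity

lemma integral_pow_gammaMeasure (hν : 0 < ν) (n : ℕ) :
    ∫ x, x ^ n ∂(gammaMeasure ν ν) = Real.Gamma (ν + n) / (Real.Gamma ν * ν ^ n) := by
  rw [gammaMeasure, integral_withDensity_eq_integral_toReal_smul
    (by unfold gammaPDF; fun_prop) (by simp [gammaPDF])]
  simp only [gammaPDF, ENNReal.toReal_ofReal (gammaPDFReal_nonneg hν hν _), smul_eq_mul]
  exact integral_gammaPDFReal_mul_pow hν n

lemma integral_id_gammaMeasure (hν : 0 < ν) : ∫ x, x ∂(gammaMeasure ν ν) = 1 := by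
  have h := integral_pow_gammaMeasure hν 1
  have := (Real.Gamma_pos_of_pos hν).ne'
  simp only [pow_one, Nat.cast_one, Real.Gamma_add_one hν.ne'] at h
  rw [h]
  field_simp

lemma integral_sq_gammaMeasure (hν : 0 < ν) : ∫ x, x ^ 2 ∂(gammaMeasure ν ν) = 1 + 1 / ν := by
  have h := integral_pow_gammaMeasure hν 2
  have := (Real.Gamma_pos_of_pos hν).ne'
  rw [h, show ν + (2 : ℕ) = (ν + 1) + 1 by push_cast; ring, Real.Gamma_add_one (by positivity),
    Real.Gamma_add_one hν.ne']
  field_simp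

lemma ae_nonneg_gammaMeasure : ∀ᵐ x ∂(gammaMeasure ν ν), 0 ≤ x := by
  rw [gammaMeasure, ae_withDensity_iff (by unfold gammaPDF; fun_prop)]
  refine ae_of_all _ fun x hx => ?_
  by_contra! h
  exact hx (gammaPDF_of_neg h)

end GammaMoments

lemma HasLowSNRExpansion.eventually_abs_sub_le {C : ℝ → ℝ} {c₁ c₂ : ℝ}
    (h : HasLowSNRExpansion C c₁ c₂) {η : ℝ} (hη : 0 < η) :
    ∃ δ : ℝ, 0 < δ ∧ ∀ s, 0 < s → s < δ → |C s - (c₁ * s + c₂ * s ^ 2)| ≤ η * s ^ 2 := by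
  obtain ⟨δ, hδ, hs⟩ := mem_nhdsGT_iff_exists_Ioo_subset.1 (h.bound hη)
  refine ⟨δ, hδ, fun s h0 h1 => ?_⟩
  have := hs ⟨h0, h1⟩
  simpa using this

section Average

variable {C : ℝ → ℝ} {γ : Measure ℝ} {K : ℝ}

lemma integrable_comp_mul_of_linear_growth [IsProbabilityMeasure γ] (hC : Continuous C)
    (hK : ∀ s, 0 ≤ s → |C s| ≤ K * (1 + s)) (hγ : ∀ᵐ g ∂γ, 0 ≤ g)
    (h1 : Integrable (fun g : ℝ => g) γ) {s : ℝ} (hs : 0 ≤ s) :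
    Integrable (fun g => C (g * s)) γ := by
  have hb : Integrable (fun g => K * (1 + g * s)) γ :=
    ((integrable_const 1).add (h1.mul_const s)).const_mul K
  refine hb.mono' ?_ ?_
  · exact (hC.comp (by fun_prop)).aestronglyMeasurable
  · filter_upwards [hγ] with g hg using hK _ (mul_nonneg hg hs)

lemma continuousAt_average [IsProbabilityMeasure γ] (hC : Continuous C)
    (hK0 : 0 ≤ K) (hK : ∀ s, 0 ≤ s → |C s| ≤ K * (1 + s)) (hγ : ∀ᵐ g ∂γ, 0 ≤ g)
    (h1 : Integrable (fun g : ℝ => g) γ) {s₀ : ℝ} (hs : 0 < s₀) :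
    ContinuousAt (fun s => ∫ g, C (g * s) ∂γ) s₀ := by
  apply continuousAt_of_dominated (bound := fun g => K * (1 + g * (s₀ + 1)))
  · exact Eventually.of_forall fun s => (hC.comp (by fun_prop)).aestronglyMeasurable
  · filter_upwards [Ioo_mem_nhds hs (lt_add_one s₀)] with s hs'
    filter_upwards [hγ] with g hg
    refine (hK _ (mul_nonneg hg hs'.1.le)).trans ?_
    have := hs'.2.le
    gcongr
  · exact ((integrable_const 1).add (h1.mul_const (s₀ + 1))).const_mul K
  · exact ae_of_all _ fun g => (hC.comp (by fun_prop)).continuousAt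

lemma average_mono [IsProbabilityMeasure γ] (hC : Continuous C)
    (hK : ∀ s, 0 ≤ s → |C s| ≤ K * (1 + s)) (hγ : ∀ᵐ g ∂γ, 0 ≤ g)
    (h1 : Integrable (fun g : ℝ => g) γ)
    (hmono : ∀ s s', 0 ≤ s → s ≤ s' → C s ≤ C s') {s s' : ℝ} (hs : 0 ≤ s) (h : s ≤ s') :
    ∫ g, C (g * s) ∂γ ≤ ∫ g, C (g * s') ∂γ := by
  refine integral_mono_ae (integrable_comp_mul_of_linear_growth hC hK hγ h1 hs)
    (integrable_comp_mul_of_linear_growth hC hK hγ h1 (hs.trans h)) ?_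
  filter_upwards [hγ] with g hg
  exact hmono _ _ (mul_nonneg hg hs) (mul_le_mul_of_nonneg_left h hg)

lemma log_one_add_le_tangent {T t : ℝ} (hT : 0 ≤ T) (ht : 0 ≤ t) :
    Real.log (1 + t) ≤ Real.log (1 + T) + (t - T) / (1 + T) := by
  have h := Real.log_le_sub_one_of_pos (x := (1 + t) / (1 + T)) (by positivity)
  rw [Real.log_div (by positivity) (by positivity)] at h
  have : (1 + t) / (1 + T) - 1 = (t - T) / (1 + T) := by
    field_simp
    ring
  linarith

/-- Jensen's inequality: the tangent to `log (1 + ·)` at `s` lies above it, and its linear term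
averages to `0` because the gain has mean `1`. -/
lemma average_le_log [IsProbabilityMeasure γ] (hC : Continuous C)
    (hK : ∀ s, 0 ≤ s → |C s| ≤ K * (1 + s)) (hγ : ∀ᵐ g ∂γ, 0 ≤ g)
    (h1 : Integrable (fun g : ℝ => g) γ) (hm : ∫ g, g ∂γ = 1)
    (hlog : ∀ s, 0 ≤ s → C s ≤ Real.log (1 + s)) {s : ℝ} (hs : 0 ≤ s) :
    ∫ g, C (g * s) ∂γ ≤ Real.log (1 + s) := by
  have hi : Integrable (fun g : ℝ => (g - 1) * (s / (1 + s))) γ :=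
    (h1.sub (integrable_const 1)).mul_const _
  calc _ ≤ ∫ g, (Real.log (1 + s) + (g - 1) * (s / (1 + s))) ∂γ := by
        refine integral_mono_ae (integrable_comp_mul_of_linear_growth hC hK hγ h1 hs)
          ((integrable_const _).add hi) ?_
        filter_upwards [hγ] with g hg
        have hgs := mul_nonneg hg hs
        refine (hlog _ hgs).trans ((log_one_add_le_tangent hs hgs).trans_eq ?_)
        ring
    _ = _ := by
        rw [integral_add (integrable_const _) hi, integral_mul_const,
          integral_sub h1 (integrable_const _), hm]
        simp

/-- Beyond the range of the expansion, `s ≥ δ` turns constant and linear growth into multiples of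
`s²`. This supplies the dominating function `B g²` for averaging over the gain. -/
lemma HasLowSNRExpansion.exists_global_bound {c₁ c₂ : ℝ}
    (hK0 : 0 ≤ K) (hK : ∀ s, 0 ≤ s → |C s| ≤ K * (1 + s)) (h0 : C 0 = 0)
    (h : HasLowSNRExpansion C c₁ c₂) :
    ∃ B : ℝ, ∀ s, 0 ≤ s → |C s - (c₁ * s + c₂ * s ^ 2)| ≤ B * s ^ 2 := by
  obtain ⟨δ, hδ, hs⟩ := h.eventually_abs_sub_le one_pos
  refine ⟨1 + (K / δ ^ 2 + (K + |c₁|) / δ + |c₂|), fun s hs0 => ?_⟩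
  rcases hs0.eq_or_lt with rfl | hpos
  · simp [h0]
  have hB : 0 ≤ K / δ ^ 2 + (K + |c₁|) / δ + |c₂| := by positivity
  have hs2 : 0 ≤ s ^ 2 := sq_nonneg s
  rcases lt_or_ge s δ with hlt | hge
  · have := mul_nonneg hB hs2
    linarith [hs s hpos hlt]
  · have e1 : K ≤ K / δ ^ 2 * s ^ 2 := by
      rw [div_mul_eq_mul_div, le_div_iff₀ (by positivity)]
      gcongr
    have e2 : (K + |c₁|) * s ≤ (K + |c₁|) / δ * s ^ 2 := by
      rw [div_mul_eq_mul_div, le_div_iff₀ hδ, sq, ← mul_assoc]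
      gcongr
    have t1 := abs_sub (C s) (c₁ * s + c₂ * s ^ 2)
    have t2 := abs_add_le (c₁ * s) (c₂ * s ^ 2)
    rw [abs_mul, abs_mul, abs_of_nonneg hs0, abs_of_nonneg hs2] at t2
    linarith [hK s hs0]

/-- Dominated convergence for the remainder divided by `s²`: it tends to `0` for each fixed gain,
and the main terms integrate to the first two moments. -/
lemma HasLowSNRExpansion.average {c₁ c₂ : ℝ} [IsProbabilityMeasure γ] (hC : Continuous C)
    (hK0 : 0 ≤ K) (hK : ∀ s, 0 ≤ s → |C s| ≤ K * (1 + s)) (h0 : C 0 = 0)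
    (hγ : ∀ᵐ g ∂γ, 0 ≤ g) (h1 : Integrable (fun g : ℝ => g) γ) (hm : ∫ g, g ∂γ = 1)
    (h2 : Integrable (fun g : ℝ => g ^ 2) γ) (h : HasLowSNRExpansion C c₁ c₂) :
    HasLowSNRExpansion (fun s => ∫ g, C (g * s) ∂γ) c₁ (c₂ * ∫ g, g ^ 2 ∂γ) := by
  obtain ⟨B, hB⟩ := h.exists_global_bound hK0 hK h0
  have hpos : ∀ᶠ s : ℝ in 𝓝[>] 0, 0 < s := eventually_mem_nhdsWithin
  unfold HasLowSNRExpansion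
  rw [isLittleO_iff_tendsto' (hpos.mono fun s hs h => absurd h (by positivity))]
  have hlim : Tendsto (fun s => ∫ g, (C (g * s) - (c₁ * (g * s) + c₂ * (g * s) ^ 2)) / s ^ 2 ∂γ)
      (𝓝[>] 0) (𝓝 (∫ _, (0 : ℝ) ∂γ)) := by
    apply tendsto_integral_filter_of_dominated_convergence (fun g => B * g ^ 2)
    · refine Eventually.of_forall fun s => Continuous.aestronglyMeasurable ?_
      fun_prop
    · filter_upwards [hpos] with s hs
      filter_upwards [hγ] with g hg
      rw [norm_div, Real.norm_eq_abs, Real.norm_eq_abs, abs_of_nonneg (sq_nonneg s),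
        div_le_iff₀ (by positivity)]
      refine (hB _ (mul_nonneg hg hs.le)).trans_eq ?_
      ring
    · exact h2.const_mul B
    · filter_upwards [hγ] with g hg
      rcases hg.eq_or_lt with rfl | hg0
      · simp [h0]
      · have ht : Tendsto (fun s : ℝ => g * s) (𝓝[>] 0) (𝓝[>] 0) := by
          refine tendsto_nhdsWithin_iff.2 ⟨?_, hpos.mono fun s hs => mul_pos hg0 hs⟩
          have : Tendsto (fun s : ℝ => g * s) (𝓝 0) (𝓝 (g * 0)) :=
            (continuous_const_mul g).tendsto 0
          rw [mul_zero] at this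
          exact this.mono_left nhdsWithin_le_nhds
        have hc := (h.comp_tendsto ht).tendsto_div_nhds_zero
        have := hc.const_mul (g ^ 2)
        rw [mul_zero] at this
        refine this.congr' ?_
        filter_upwards [hpos] with s hs
        simp only [Function.comp_apply]
        field_simp
  rw [integral_zero] at hlim
  refine hlim.congr' ?_
  filter_upwards [hpos] with s hs
  have i1 := integrable_comp_mul_of_linear_growth hC hK hγ h1 hs.le
  have i2 : Integrable (fun g => c₁ * (g * s)) γ := (h1.mul_const s).const_mul _
  have i3 : Integrable (fun g => c₂ * (g * s) ^ 2) γ := by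
    simp only [mul_pow]
    exact (h2.mul_const _).const_mul _
  rw [integral_div]
  have i23 : Integrable (fun g => c₁ * (g * s) + c₂ * (g * s) ^ 2) γ := i2.add i3
  rw [integral_sub i1 i23, integral_add i2 i3]
  simp only [mul_pow]
  rw [integral_const_mul, integral_const_mul, integral_mul_const, integral_mul_const, hm]
  ring

end Average

/-! ### The trade-off between bandwidth and power -/

lemma log_one_add_le_sub_sq {s : ℝ} (h0 : 0 ≤ s) (h : s ≤ 1 / 8) :
    Real.log (1 + s) ≤ s - s ^ 2 / 4 := by
  have hb := Real.abs_log_sub_add_sum_range_le (x := -s)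
    (by rw [abs_neg, abs_of_nonneg h0]; linarith) 2
  rw [abs_neg, abs_of_nonneg h0, sub_neg_eq_add] at hb
  have hq : s ^ (2 + 1) / (1 - s) ≤ s ^ 2 / 4 := by
    rw [div_le_iff₀ (by linarith)]
    have : 0 ≤ s ^ 2 := sq_nonneg s
    nlinarith
  have := (abs_le.1 hb).2
  norm_num [Finset.sum_range_succ] at this
  linarith

/-- The second-order coefficient is negative. -/
lemma HasLowSNRExpansion.coeff_neg {C : ℝ → ℝ} {c₂ : ℝ} (h : HasLowSNRExpansion C 1 c₂)
    (hlog : ∀ s, 0 ≤ s → C s ≤ Real.log (1 + s)) : c₂ < 0 := by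
  -- If `c₂ ≥ 0`, then `s - s²/8 ≤ C s ≤ log (1 + s) ≤ s - s²/4`, which is absurd.
  obtain ⟨δ, hδ, hs⟩ := h.eventually_abs_sub_le (η := 1 / 8) (by norm_num)
  obtain ⟨s, h0, h1⟩ := exists_between (lt_min hδ (by norm_num : (0 : ℝ) < 1 / 8))
  have a := (abs_le.1 (hs s h0 (h1.trans_le (min_le_left _ _)))).1
  have b := log_one_add_le_sub_sq h0.le (h1.le.trans (min_le_right _ _))
  have c := hlog s h0.le
  by_contra! hc
  have : 0 < s ^ 2 := by positivity
  nlinarith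

/-- A bound `log (1 + t) ≤ (1 - β) t`, uniform for `t` away from zero. -/
lemma exists_log_one_add_le_mul {t₀ : ℝ} (ht₀ : 0 < t₀) :
    ∃ β : ℝ, 0 < β ∧ ∀ t, t₀ ≤ t → Real.log (1 + t) ≤ (1 - β) * t := by
  have h1 : Real.log (1 + t₀) / t₀ < 1 := by
    rw [div_lt_one ht₀]
    have := Real.log_lt_sub_one_of_pos (x := 1 + t₀) (by positivity) (by linarith)
    linarith
  have h2 : 1 / (1 + t₀) < 1 := by
    rw [div_lt_one (by positivity)]
    linarith
  -- `b` exceeds both the chord slope from `0` to `t₀` and the tangent slope at `t₀`, so the line `b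
  -- * t` stays above the tangent beyond `t₀`.
  obtain ⟨b, hb, hb1⟩ := exists_between (max_lt h1 h2)
  refine ⟨1 - b, by linarith, fun t ht => ?_⟩
  have e1 := ((div_le_iff₀ ht₀).1 ((le_max_left _ _).trans hb.le))
  have e2 := mul_le_mul_of_nonneg_right ((le_max_right _ _).trans hb.le) (sub_nonneg.2 ht)
  have := log_one_add_le_tangent ht₀.le (ht₀.le.trans ht)
  rw [div_eq_mul_one_div, mul_comm (t - t₀)] at this
  linarith

/-- Sublinearity of the logarithm, which makes `D t / t` small for some `t`. The tangent at `2/v`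
bounds the logarithm at `4/v²` by `2/v + 2/v`. -/
lemma exists_log_one_add_le_small_mul {v : ℝ} (hv : 0 < v) :
    ∃ t, 0 < t ∧ Real.log (1 + t) ≤ v * t := by
  have hT : 0 < 2 / v := by positivity
  refine ⟨4 / v ^ 2, by positivity, ?_⟩
  have h := log_one_add_le_tangent hT.le (by positivity : 0 ≤ 4 / v ^ 2)
  have h1 := Real.log_le_sub_one_of_pos (x := 1 + 2 / v) (by positivity)
  have h2 : (4 / v ^ 2 - 2 / v) / (1 + 2 / v) ≤ 2 / v := by
    rw [div_le_iff₀ (by positivity)]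
    have e : 2 / v * (1 + 2 / v) = 4 / v ^ 2 + 2 / v := by field_simp; ring
    linarith
  have e : v * (4 / v ^ 2) = 2 / v + 2 / v := by field_simp; norm_num
  linarith

section Tradeoff

variable {C D : ℝ → ℝ} {c₂ κ : ℝ}

lemma HasLowSNRExpansion.eventually_abs_sub_id_le {c : ℝ} (h : HasLowSNRExpansion C 1 c) {L : ℝ}
    (hL : |c| + 1 ≤ L) :
    ∃ δ : ℝ, 0 < δ ∧ ∀ s, 0 < s → s < δ → |C s - s| ≤ L * s ^ 2 := by
  obtain ⟨δ, hδ, hs⟩ := h.eventually_abs_sub_le one_pos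
  refine ⟨δ, hδ, fun s h0 h1 => ?_⟩
  have a := abs_le.1 (hs s h0 h1)
  have hsq : 0 ≤ s ^ 2 := sq_nonneg s
  have b := abs_le.1 (le_refl |c|)
  have b1 := mul_le_mul_of_nonneg_right b.1 hsq
  have b2 := mul_le_mul_of_nonneg_right b.2 hsq
  have b3 := mul_le_mul_of_nonneg_right hL hsq
  rw [abs_le]
  constructor <;> linarith

/-- The bandwidth trade-off, in terms of the signal-to-noise ratios `s` and `t`. -/
lemma bandwidth_tradeoff (hC : HasLowSNRExpansion C 1 c₂) (hD : HasLowSNRExpansion D 1 (c₂ * κ))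
    (hκ : 0 < κ) (hClog : ∀ s, 0 ≤ s → C s ≤ Real.log (1 + s))
    (hDlog : ∀ s, 0 ≤ s → D s ≤ Real.log (1 + s))
    (hDcont : ContinuousOn D (Set.Ioi 0)) {ε : ℝ} (hε : 0 < ε) :
    ∃ δ : ℝ, 0 < δ ∧ ∀ s, 0 < s → s < δ →
      (∃ t, 0 < t ∧ s * D t = t * C s) ∧ ∀ t, 0 < t → s * D t = t * C s → |s / t - κ| ≤ ε := by
  have hc := hC.coeff_neg hClog
  -- The final estimate is `|r - κ| ≤ η (r + 1)` for `r = s / t`. Here `η ≤ 1/2` gives `r ≤ 2κ + 1`,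
  -- and the other bound then gives `ε`.
  set η := min (1 / 2) (ε / (2 * κ + 2)) with hη
  have hη0 : 0 < η := by positivity
  have hη1 : η ≤ 1 / 2 := min_le_left _ _
  have hη2 : η * (2 * κ + 2) ≤ ε := (le_div_iff₀ (by positivity)).1 (min_le_right _ _)
  have hη' : 0 < -c₂ * η := mul_pos (by linarith) hη0
  obtain ⟨δ₁, hδ₁, h₁⟩ := hC.eventually_abs_sub_le hη'
  obtain ⟨δ₂, hδ₂, h₂⟩ := hD.eventually_abs_sub_le hη'
  obtain ⟨β, hβ, hβt⟩ := exists_log_one_add_le_mul hδ₂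
  obtain ⟨δ₃, hδ₃, h₃⟩ := hC.eventually_abs_sub_id_le (le_refl _)
  obtain ⟨δ₄, hδ₄, h₄⟩ := hD.eventually_abs_sub_id_le (le_refl _)
  set L := |c₂| + 1 with hL
  have hL0 : 0 < L := by positivity
  set L' := |c₂ * κ| + 1 with hL'
  have hL'0 : 0 < L' := by positivity
  -- `s < 1/L` makes `C s` positive; `s < β/L` makes `C s / s` exceed `1 - β`.
  refine ⟨min (min δ₁ δ₃) (min (β / L) (1 / L)), by positivity, fun s hs hsδ => ?_⟩
  simp only [lt_min_iff] at hsδ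
  obtain ⟨⟨hs1, hs3⟩, hsβ, hs4⟩ := hsδ
  rw [lt_div_iff₀ hL0] at hsβ hs4
  have hCs := abs_le.1 (h₃ s hs hs3)
  have hCpos : 0 < C s := by nlinarith [hCs.1]
  have hClt : C s < s := (hClog s hs.le).trans_lt (by
    have := Real.log_lt_sub_one_of_pos (x := 1 + s) (by positivity) (by linarith)
    linarith)
  refine ⟨?_, fun t ht heq => ?_⟩
  -- `D t / t` is at most `C s / s` at `t₂`, and at least `C s / s` at a small `t₁`, since it tends
  -- to `1` at `0` while `C s / s < 1`.
  · obtain ⟨t₂, ht₂, hlog⟩ := exists_log_one_add_le_small_mul (div_pos hCpos hs)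
    have hlow : s * D t₂ ≤ t₂ * C s := by
      have := mul_le_mul_of_nonneg_left ((hDlog t₂ ht₂.le).trans hlog) hs.le
      have e : s * (C s / s * t₂) = t₂ * C s := by field_simp
      linarith
    obtain ⟨t₁, ht₁, ht₁'⟩ := exists_between
      (lt_min hδ₄ (div_pos (sub_pos.2 hClt) (mul_pos hs hL'0)))
    rw [lt_min_iff, lt_div_iff₀ (mul_pos hs hL'0)] at ht₁'
    have hhigh : t₁ * C s ≤ s * D t₁ := by
      have a := (abs_le.1 (h₄ t₁ ht₁ ht₁'.1)).1
      have b := mul_le_mul_of_nonneg_left a hs.le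
      have c := mul_le_mul_of_nonneg_left ht₁'.2.le ht₁.le
      linarith
    obtain ⟨t, ht, he⟩ := isPreconnected_Ioi.intermediate_value₂ ht₂ ht₁
      (hDcont.const_mul s) (by fun_prop : ContinuousOn (fun t => t * C s) (Set.Ioi 0)) hlow hhigh
    exact ⟨t, ht, he⟩
  -- A solution with `t ≥ δ₂` would give `C s / s = D t / t ≤ 1 - β`.
  · have htδ : t < δ₂ := by
      by_contra! hge
      have a := mul_le_mul_of_nonneg_left ((hDlog t ht.le).trans (hβt t hge)) hs.le
      rw [heq] at a
      have b : C s ≤ (1 - β) * s := by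
        have : t * C s ≤ t * ((1 - β) * s) := by linarith
        exact le_of_mul_le_mul_left this ht
      nlinarith [hCs.1]
    have a := abs_le.1 (h₁ s hs hs1)
    have b := abs_le.1 (h₂ t ht htδ)
    obtain ⟨r, hr⟩ : ∃ r, r = s / t := ⟨_, rfl⟩
    rw [← hr]
    have hr0 : 0 < r := hr ▸ div_pos hs ht
    have hsr : s = r * t := by rw [hr]; field_simp
    have heq' : C s = r * D t := by
      have : t * C s = t * (r * D t) := by rw [← heq, hsr]; ring
      exact mul_left_cancel₀ ht.ne' this
    -- In `C (r t) = r D t` the terms `r t` cancel; what remains is divided by `-c₂ r t²`, positive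
    -- because `c₂ < 0`.
    rw [heq', hsr] at a
    have hrt : 0 < r * t ^ 2 := by positivity
    have hbr1 := mul_le_mul_of_nonneg_left b.1 hr0.le
    have hbr2 := mul_le_mul_of_nonneg_left b.2 hr0.le
    have hrt2 : 0 < (-c₂) * (r * t ^ 2) := mul_pos (by linarith) hrt
    have k1 : r - κ ≤ η * (r + 1) := by
      refine le_of_mul_le_mul_left ?_ hrt2
      linarith [a.1, a.2]
    have k2 : -(η * (r + 1)) ≤ r - κ := by
      refine le_of_mul_le_mul_left ?_ hrt2
      linarith [a.1, a.2]
    have hr2 : r ≤ 2 * κ + 1 := by nlinarith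
    have k3 : η * (r + 1) ≤ ε := by nlinarith
    rw [abs_le]
    constructor <;> linarith

/-- The power trade-off, in terms of the signal-to-noise ratios `s` and `t`. -/
lemma power_tradeoff (hC : HasLowSNRExpansion C 1 c₂) (hD : HasLowSNRExpansion D 1 (c₂ * κ))
    (hClog : ∀ s, 0 ≤ s → C s ≤ Real.log (1 + s))
    (hDmono : ∀ s s', 0 ≤ s → s ≤ s' → D s ≤ D s')
    (hDcont : ContinuousOn D (Set.Ioi 0)) {ε : ℝ} (hε : 0 < ε) :
    ∃ δ : ℝ, 0 < δ ∧ ∀ s, 0 < s → s < δ →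
      (∃ t, 0 < t ∧ D t = C s) ∧
        ∀ t, 0 < t → D t = C s → |t / s - (1 - c₂ * (κ - 1) * s)| ≤ ε * s := by
  set L := |c₂| + |c₂ * κ| + 1 with hL
  have hL0 : 0 < L := by positivity
  obtain ⟨δ₁, hδ₁, h₁⟩ := hC.eventually_abs_sub_le (η := ε / 10) (by positivity)
  obtain ⟨δ₂, hδ₂, h₂⟩ := hD.eventually_abs_sub_le (η := ε / 10) (by positivity)
  obtain ⟨δ₃, hδ₃, h₃⟩ := hC.eventually_abs_sub_id_le (L := L)
    (by linarith [abs_nonneg (c₂ * κ)])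
  obtain ⟨δ₄, hδ₄, h₄⟩ := hD.eventually_abs_sub_id_le (L := L) (by linarith [abs_nonneg c₂])
  -- A threshold with `D t₀ > t₀ / 2`: since `C s ≤ s < t₀ / 2`, monotonicity of `D` forces every
  -- solution below `t₀`.
  obtain ⟨t₀, ht₀, ht₀'⟩ := exists_between
    (lt_min (lt_min hδ₂ hδ₄) (by positivity : 0 < 1 / (4 * L)))
  simp only [lt_min_iff] at ht₀'
  obtain ⟨⟨ht2, ht4⟩, htL⟩ := ht₀'
  rw [lt_div_iff₀ (by positivity)] at htL
  have hDt₀ : t₀ / 2 < D t₀ := by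
    have := (abs_le.1 (h₄ t₀ ht₀ ht4)).1
    nlinarith
  -- `5 L s ≤ 1` is what `2s - 4Ls² ≥ s + Ls²` needs at the endpoint `2s`. The last bound reduces
  -- the error `15 L² s³` of replacing `t²` by `s²` to `ε s² / 2`; the two remainders use the other
  -- half, as `t² ≤ 4s²`.
  refine ⟨min (min (min δ₁ δ₃) (t₀ / 2)) (min (1 / (5 * L)) (ε / (30 * L ^ 2))), by positivity,
    fun s hs hsδ => ?_⟩
  simp only [lt_min_iff] at hsδ
  obtain ⟨⟨⟨hs1, hs3⟩, hst⟩, hs5, hs6⟩ := hsδ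
  rw [lt_div_iff₀ (by positivity)] at hs5 hs6
  have hCs := abs_le.1 (h₃ s hs hs3)
  have hsq : 0 < s ^ 2 := by positivity
  have hLs : L * s ^ 2 ≤ s / 5 := by nlinarith
  refine ⟨?_, fun t ht heq => ?_⟩
  · have a := (abs_le.1 (h₄ (2 * s) (by linarith) (by linarith))).1
    have b := (abs_le.1 (h₄ (s / 2) (by linarith) (by linarith))).2
    obtain ⟨t, ht, he⟩ := isPreconnected_Ioi.intermediate_value₂ (a := s / 2) (b := 2 * s)
      (Set.mem_Ioi.2 (by linarith)) (Set.mem_Ioi.2 (by linarith)) hDcont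
      (continuousOn_const (c := C s)) (by nlinarith) (by nlinarith)
    exact ⟨t, ht, he⟩
  · have hCle : C s ≤ s := (hClog s hs.le).trans (by
      have := Real.log_le_sub_one_of_pos (x := 1 + s) (by positivity)
      linarith)
    have htt : t < t₀ := by
      by_contra! hge
      have := hDmono t₀ t ht₀.le hge
      linarith
    have b := abs_le.1 (h₄ t ht (by linarith))
    have hLt : L * t ^ 2 ≤ t / 4 := by nlinarith
    have ht2s : t ≤ 2 * s := by linarith [b.1]
    have ht2 : t ^ 2 ≤ 4 * s ^ 2 := by nlinarith
    have hd : |t - s| ≤ 5 * L * s ^ 2 := by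
      have := mul_le_mul_of_nonneg_left ht2 hL0.le
      rw [abs_le]
      constructor <;> linarith [b.1, b.2, hCs.1, hCs.2]
    have hd2 : |c₂ * κ * (t ^ 2 - s ^ 2)| ≤ 15 * L ^ 2 * s ^ 3 := by
      have e : t ^ 2 - s ^ 2 = (t - s) * (t + s) := by ring
      rw [e, abs_mul (c₂ * κ), abs_mul (t - s), abs_of_pos (by linarith : 0 < t + s)]
      calc |c₂ * κ| * (|t - s| * (t + s)) ≤ L * ((5 * L * s ^ 2) * (3 * s)) := by
            gcongr
            · linarith [abs_nonneg c₂]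
            · linarith
        _ = _ := by ring
    have p := abs_le.1 (h₁ s hs hs1)
    have q := abs_le.1 (h₂ t ht (by linarith))
    have hd2' := abs_le.1 hd2
    have h6 : 15 * L ^ 2 * s ^ 3 ≤ ε / 2 * s ^ 2 := by
      have := mul_le_mul_of_nonneg_right hs6.le hsq.le
      linarith
    have ht2' := mul_le_mul_of_nonneg_left ht2 (by positivity : 0 ≤ ε / 10)
    have e : t / s - (1 - c₂ * (κ - 1) * s) = (t - s + c₂ * (κ - 1) * s ^ 2) / s := by
      field_simp
      ring
    rw [e, abs_div, abs_of_pos hs, div_le_iff₀ hs, abs_le]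
    constructor <;> linarith

end Tradeoff

/-! ### Nakagami laws, and the translation into bandwidth and power. -/

lemma IsNakagami.isProbabilityMeasure {ν : ℝ} (hν : 0 < ν) {fading : Measure ℂ}
    (h : IsNakagami ν fading) : IsProbabilityMeasure fading := by
  have hp := isProbabilityMeasure_gammaMeasure hν hν
  rw [← h] at hp
  exact Measure.isProbabilityMeasure_of_map (fun h : ℂ => ‖h‖ ^ 2)

lemma IsNakagami.integrable_norm_sq {ν : ℝ} (hν : 0 < ν) {fading : Measure ℂ}
    (h : IsNakagami ν fading) : Integrable (fun h : ℂ => ‖h‖ ^ 2) fading := by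
  have hi := integrable_pow_gammaMeasure hν 1
  simp only [pow_one] at hi
  rw [← h] at hi
  exact hi.comp_measurable (by fun_prop)

end

theorem corollary5 (X : Constellation) (hX : X.energy = 1) :
    (∃ c₁ c₂ : ℝ, HasLowSNRExpansion (X.capacity noFading) c₁ c₂) ∧
    ∀ c₂ : ℝ, HasLowSNRExpansion (X.capacity noFading) 1 c₂ →
    ∀ ν : ℝ, 0 < ν → ∀ fading : Measure ℂ, IsNakagami ν fading →
    ∀ ε : ℝ, 0 < ε → ∃ δ : ℝ, 0 < δ ∧
    ∀ N₀ P W : ℝ, 0 < N₀ → 0 < P → 0 < W → signalToNoise N₀ P W < δ →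
      ((∃ Wν : ℝ, 0 < Wν ∧
          dataRate (X.capacity fading) N₀ P Wν = dataRate (X.capacity noFading) N₀ P W) ∧
        ∀ Wν : ℝ, 0 < Wν →
          dataRate (X.capacity fading) N₀ P Wν = dataRate (X.capacity noFading) N₀ P W →
          |Wν / W - (1 + 1 / ν)| ≤ ε) ∧
      ((∃ Pν : ℝ, 0 < Pν ∧
          dataRate (X.capacity fading) N₀ Pν W = dataRate (X.capacity noFading) N₀ P W) ∧
        ∀ Pν : ℝ, 0 < Pν →
          dataRate (X.capacity fading) N₀ Pν W = dataRate (X.capacity noFading) N₀ P W →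
          |Pν / P - (1 - c₂ / ν * signalToNoise N₀ P W)| ≤ ε * signalToNoise N₀ P W) := by
  refine ⟨X.exists_hasLowSNRExpansion, fun c₂ hC ν hν fading hF ε hε => ?_⟩
  have := hF.isProbabilityMeasure hν
  have := isProbabilityMeasure_gammaMeasure hν hν
  have h1 : Integrable (fun g : ℝ => g) (gammaMeasure ν ν) := by
    simpa using integrable_pow_gammaMeasure hν 1
  obtain ⟨K, hK0, hK⟩ := X.exists_abs_capacity_noFading_le
  have hcont := X.continuous_capacity_noFading
  have hClog := fun s hs => X.capacity_noFading_le_log hX (s := s) hs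
  have hav : X.capacity fading =
      fun s => ∫ g, X.capacity noFading (g * s) ∂(gammaMeasure ν ν) := by
    funext s
    rw [X.capacity_eq_integral_gain (hF.integrable_norm_sq hν), hF]
  have hD : HasLowSNRExpansion (X.capacity fading) 1 (c₂ * (1 + 1 / ν)) := by
    rw [hav, ← integral_sq_gammaMeasure hν]
    exact hC.average hcont hK0 hK X.capacity_noFading_zero ae_nonneg_gammaMeasure h1
      (integral_id_gammaMeasure hν) (integrable_pow_gammaMeasure hν 2)
  have hDlog : ∀ s, 0 ≤ s → X.capacity fading s ≤ Real.log (1 + s) := fun s hs => by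
    rw [hav]
    exact average_le_log hcont hK ae_nonneg_gammaMeasure h1 (integral_id_gammaMeasure hν) hClog hs
  have hDmono : ∀ s s', 0 ≤ s → s ≤ s' → X.capacity fading s ≤ X.capacity fading s' := by
    intro s s' hs h
    rw [hav]
    exact average_mono hcont hK ae_nonneg_gammaMeasure h1
      (fun _ _ => X.capacity_noFading_mono) hs h
  have hDcont : ContinuousOn (X.capacity fading) (Set.Ioi 0) := by
    rw [hav]
    exact fun s hs =>
      (continuousAt_average hcont hK0 hK ae_nonneg_gammaMeasure h1 hs).continuousWithinAt
  obtain ⟨δ₁, hδ₁, hb⟩ :=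
    bandwidth_tradeoff hC hD (by positivity) hClog hDlog hDcont hε
  obtain ⟨δ₂, hδ₂, hp⟩ := power_tradeoff hC hD hClog hDmono hDcont hε
  refine ⟨min δ₁ δ₂, lt_min hδ₁ hδ₂, fun N₀ P W hN hP hW hs => ?_⟩
  rw [lt_min_iff] at hs
  have hs0 : 0 < signalToNoise N₀ P W := div_pos hP (mul_pos hN hW)
  obtain ⟨⟨t, ht, het⟩, hball⟩ := hb _ hs0 hs.1
  obtain ⟨⟨t', ht', het'⟩, hpall⟩ := hp _ hs0 hs.2
  -- These are the bandwidth and the power that realize the ratios `t` and `t'` found above.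
  refine ⟨⟨⟨P / (N₀ * t), by positivity, ?_⟩, fun Wν hWν heq => ?_⟩,
    ⟨⟨t' * (N₀ * W), by positivity, ?_⟩, fun Pν hPν heq => ?_⟩⟩
  · have e : signalToNoise N₀ P (P / (N₀ * t)) = t := by
      unfold signalToNoise
      field_simp
    have e' : P / (N₀ * t) = W * signalToNoise N₀ P W / t := by
      unfold signalToNoise
      field_simp
    rw [dataRate, dataRate, e, e', div_mul_eq_mul_div, div_eq_iff ht.ne', mul_assoc, het]
    ring
  · have ht : 0 < signalToNoise N₀ P Wν := div_pos hP (mul_pos hN hWν)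
    have e : signalToNoise N₀ P W / signalToNoise N₀ P Wν = Wν / W := by
      unfold signalToNoise
      field_simp
    rw [← e]
    refine hball _ ht ?_
    have e1 : signalToNoise N₀ P W = signalToNoise N₀ P Wν / W * Wν := by
      unfold signalToNoise
      field_simp
    unfold dataRate at heq
    conv_lhs => rw [e1]
    rw [mul_assoc, heq]
    field_simp
  · have e : signalToNoise N₀ (t' * (N₀ * W)) W = t' := by
      unfold signalToNoise
      field_simp
    rw [dataRate, dataRate, e, het']
  · have ht : 0 < signalToNoise N₀ Pν W := div_pos hPν (mul_pos hN hW)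
    have e : signalToNoise N₀ Pν W / signalToNoise N₀ P W = Pν / P := by
      unfold signalToNoise
      field_simp
    have := hpall _ ht (mul_left_cancel₀ hW.ne' heq)
    rw [e] at this
    rwa [show c₂ * (1 + 1 / ν - 1) = c₂ / ν by ring] at this
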